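/- Let $\Sigma$ be a finite alphabet with at least two letters, and write $\log=\log_2$. A lossless compressor is an injective map $C:\Sigma^*\to\{0,1\}^*$. It uses one read/write stream, $m(n)$ bits of memory and $p(n)$ passes if, for each $n$, some deterministic machine computes $C$ on the inputs of length $n$ as follows. The input is initially on a single read/write stream of cells. The machine has at most $2^{m(n)}$ memory configurations. In each step it reads and rewrites the current cell, moves its head by at most one cell and may emit output bits. It halts after at most $p(n)-1$ changes of direction of its head. The emitted bits form $C(s)$. For strings $w,s$ let $w_s$ be the string of the characters that immediately follow the occurrences of $w$ in $s$. Let $H_0(s)=\frac1{|s|}\sum_a \mathrm{occ}(a,s)\log\frac{|s|}{\mathrm{occ}(a,s)}$. Let $H_0^*(s)=0$ if $s$ is empty, $H_0^*(s)=(\lfloor\log|s|\rfloor+1)/|s|$ if $s$ is non-empty and $H_0(s)=0$, and $H_0^*(s)=H_0(s)$ otherwise. The $k$th-order modified empirical entropy is $H_k^*(s)=\min_S \frac1{|s|}\sum_{w\in S}|w_s|\,H_0^*(w_s)$, over all sets $S$ of words of length at most $k$ such that every word of length $k$ has exactly one suffix in $S$. The compressor $C$ achieves an entropy-only bound if there are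 a constant $\lambda$ and numbers $g_k$, depending only on $k$ (and $\Sigma$) and with $g_k\le 2^{2^{o(k)}}$ as $k\to\infty$, such that $|C(s)|\le\lambda\,|s|\,H_k^*(s)+g_k$ for all strings $s$ and all $k\ge 0$ simultaneously. Theorem. (1) No lossless compressor that uses one read/write stream, $\log^{O(1)}n$ bits of memory and $\log^{O(1)}n$ passes achieves an entropy-only bound. (2) There is a constant $\delta>0$ such that the following holds. Let $C$ be a lossless compressor that uses one read/write stream, $m(n)=\log^{O(1)}n$ bits of memory and $p(n)=\log^{O(1)}n$ passes. Let $k=k(n)$ be natural numbers with $2^{k(n)}/((m(n)+1)\,p(n))\to\infty$ and $2^{k(n)}=\log^{O(1)}n$, and let two distinct letters of $\Sigma$ be given. Then for all sufficiently large $n$ (the threshold not depending on $D$) and every map $D:\{0,1\}^*\to\{0,1\}^*$ there are a binary De Bruijn cycle $d$ of order $k(n)$ (a cyclic sequence that contains each binary $k(n)$-tuple exactly once) and a string $s$ of length $n$ such that - $d$ is incompressible with respect to $D$: every $x$ with $D(x)=d$ has length at least $\delta\,|d|$; - $s$ is a prefix of $ddd\cdots$, written in the two given letters, and so is periodic with period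 $|d|=2^{k(n)}$; - $n H_{k(n)}^*(s)\le 2\cdot 2^{k(n)}\log n$, so $n H_{k(n)}^*(s)=\log^{O(1)}n$, with the exponent independent of $D$; - $|C(s)|\ge\delta n$. -/

import Mathlib

open Filter Topology

/-! ### Machines with one read/write stream -/

/-- A head move on the stream. -/
inductive StreamMove
  | left
  | stay
  | right

/-- A deterministic machine with one read/write stream and a write-only output.
`Mem` is the (finite) set of all configurations of the internal memory, the finite control
included.  The stream is a two-way infinite sequence of cells with contents in `Cell`; the input
is presented through `embed`, every other cell is initially `blank`.  Depending on its memory and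
on the cell under the head, the machine halts (`none`), or it changes its memory, rewrites the
cell, moves the head by at most one cell, and appends a (possibly empty) block of bits to its
output.  There is no bound on the number of cell symbols or on the running time.

(A machine that leaves its result on the stream can be turned into one of this kind by one more
sweep over the stream that copies it out.) -/
structure StreamMachine (α : Type*) where
  Mem : Type
  [fintypeMem : Fintype Mem]
  Cell : Type
  blank : Cell
  embed : α → Cell
  start : Mem
  step : Mem → Cell → Option (Mem × Cell × StreamMove × List Bool)

namespace StreamMachine

variable {α : Type*}

/-- An instantaneous description.  `rightward` records whether the last proper move of the head
was to the right (`true` at the start), `reversals` counts the changes of direction so far, and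
`output` is the output produced so far. -/
structure Config (M : StreamMachine α) where
  mem : M.Mem
  head : ℤ
  tape : ℤ → M.Cell
  rightward : Bool
  reversals : ℕ
  output : List Bool

/-- The initial contents of the stream: `s` in the cells `0, …, |s| - 1`, blanks elsewhere. -/
def initTape (M : StreamMachine α) (s : List α) (i : ℤ) : M.Cell :=
  if i < 0 then M.blank else (s[i.toNat]?).elim M.blank M.embed

def init (M : StreamMachine α) (s : List α) : M.Config where
  mem := M.start
  head := 0
  tape := M.initTape s
  rightward := true
  reversals := 0
  output := []

/-- The effect on a configuration of changing the memory to `q`, writing `x` in the current cell,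
moving by `mv` and emitting `o`. -/
def Config.update {M : StreamMachine α} (c : M.Config) (q : M.Mem) (x : M.Cell)
    (mv : StreamMove) (o : List Bool) : M.Config where
  mem := q
  head := match mv with
    | .left => c.head - 1
    | .stay => c.head
    | .right => c.head + 1
  tape := Function.update c.tape c.head x
  rightward := match mv with
    | .left => false
    | .stay => c.rightward
    | .right => true
  reversals := match mv, c.rightward with
    | .left, true => c.reversals + 1
    | .right, false => c.reversals + 1
    | _, _ => c.reversals
  output := c.output ++ o

/-- One step; `none` if the machine halts in configuration `c`. -/
def next (M : StreamMachine α) (c : M.Config) : Option M.Config :=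
  (M.step c.mem (c.tape c.head)).map fun r => c.update r.1 r.2.1 r.2.2.1 r.2.2.2

/-- Started on `s`, the machine halts in configuration `c`. -/
def HaltsIn (M : StreamMachine α) (s : List α) (c : M.Config) : Prop :=
  Relation.ReflTransGen (fun a b => M.next a = some b) (M.init s) c ∧ M.next c = none

end StreamMachine

/-- The function `C` is computed with one stream, `m n` bits of memory and `p n` passes on inputs
of length `n`: the memory has at most `2 ^ m n` configurations, and the head changes direction
at most `p n - 1` times, so that it sweeps at most `p n` times over the stream.  The machine is
allowed to depend on `n`. -/
def OneStreamComputable {α : Type*} (C : List α → List Bool) (m p : ℕ → ℕ) : Prop :=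
  ∀ n : ℕ, ∃ M : StreamMachine α,
    @Fintype.card M.Mem M.fintypeMem ≤ 2 ^ m n ∧
    ∀ s : List α, s.length = n →
      ∃ c : M.Config, M.HaltsIn s c ∧ c.output = C s ∧ c.reversals + 1 ≤ p n

/-- `f n = (log n) ^ O(1)`. -/
def PolyLog (f : ℕ → ℕ) : Prop :=
  ∃ c : ℕ, ∀ᶠ n : ℕ in atTop, (f n : ℝ) ≤ (Real.logb 2 n) ^ c

/-! ### Empirical entropy -/

section Entropy

variable {α : Type*} [DecidableEq α]

/-- The string `w_s` of the characters that immediately follow the occurrences of `w` in `s`,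
from left to right. -/
def followers (w s : List α) : List α :=
  (List.range s.length).filterMap fun i =>
    if (s.drop i).take w.length = w then s[i + w.length]? else none

/-- Zeroth-order empirical entropy `(1 / n) ∑ₐ occ(a, s) log (n / occ(a, s))`. -/
noncomputable def empEntropyZero [Fintype α] (s : List α) : ℝ :=
  (1 / (s.length : ℝ)) *
    ∑ a : α, (s.count a : ℝ) * Real.logb 2 ((s.length : ℝ) / (s.count a : ℝ))

/-- Zeroth-order modified empirical entropy: as `empEntropyZero`, except that a nonempty string
of zero entropy is charged `⌊log n⌋ + 1` bits in total, the length of `n` in binary. -/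
noncomputable def modEntropyZero [Fintype α] (s : List α) : ℝ :=
  if s = [] then 0
  else if empEntropyZero s = 0 then (1 / (s.length : ℝ)) * ((Nat.log 2 s.length : ℝ) + 1)
  else empEntropyZero s

/-- `S` is a suffix cover of the words of length `k`: its members have length at most `k`, and
every word of length `k` has exactly one suffix in `S`. -/
def IsSuffixCover (k : ℕ) (S : Finset (List α)) : Prop :=
  (∀ w ∈ S, w.length ≤ k) ∧ ∀ v : List α, v.length = k → ∃! w, w ∈ S ∧ w <:+ v

/-- Manzini's `k`th-order modified empirical entropy `H_k^*(s)`: the minimum, over all suffix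
covers `S` of the words of length `k`, of `(1 / |s|) ∑_{w ∈ S} |w_s| H_0^*(w_s)`. -/
noncomputable def modEntropy [Fintype α] (k : ℕ) (s : List α) : ℝ :=
  sInf {h : ℝ | ∃ S : Finset (List α), IsSuffixCover k S ∧
    h = (1 / (s.length : ℝ)) *
      ∑ w ∈ S, ((followers w s).length : ℝ) * modEntropyZero (followers w s)}

/-- `C` achieves an entropy-only bound: `|C(s)| ≤ lam · n H_k^*(s) + g_k` for all strings `s`
and all `k` simultaneously, where `g_k` depends only on `k` (and the alphabet) and grows with `k`
more slowly than doubly exponentially, `g_k ≤ 2 ^ (2 ^ o(k))`. -/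
def AchievesEntropyOnlyBound [Fintype α] (C : List α → List Bool) : Prop :=
  ∃ (lam : ℝ) (g : ℕ → ℝ),
    (∀ ε : ℝ, 0 < ε → ∀ᶠ k : ℕ in atTop, g k ≤ (2 : ℝ) ^ ((2 : ℝ) ^ (ε * (k : ℝ)))) ∧
    ∀ (k : ℕ) (s : List α),
      ((C s).length : ℝ) ≤ lam * ((s.length : ℝ) * modEntropy k s) + g k

end Entropy

/-- `d`, read cyclically, contains every word of length `k` exactly once. -/
def IsDeBruijnCycle {β : Type*} (k : ℕ) (d : List β) : Prop :=
  ∀ w : List β, w.length = k → ∃! i : ℕ, i < d.length ∧ (d.rotate i).take k = w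

/-- `s` is a prefix of the infinite repetition `d d d ⋯`. -/
def IsPrefixOfPowers {β : Type*} (d s : List β) : Prop :=
  ∃ r : ℕ, s <+: (List.replicate r d).flatten

/-!
A machine with little memory and few passes can transfer little information across the borders of
a block of cells.  Cut the stream into blocks of `2 ^ k` cells.  The *trace* of a run over a block
is the sequence of the bits emitted while the head is in the block, interleaved with the border
crossings, each recorded with the memory and the direction.  If the runs on two inputs `s` and
`s'` leave the same trace over a block, then on the hybrid input, which is `s` with the block
replaced by that of `s'`, the machine behaves like the run on `s` outside the block and like the
run on `s'` inside it, so that it emits the same bits as on `s`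
(`StreamMachine.HaltingRun.exists_hybrid`).  For an injective compressor the trace over a block
therefore determines the content of the block.  A run with `p` passes has at most `2 p` crossings,
hence a trace with few emitted bits has a short binary code, and over each block all but few of
the possible contents cause much output (`OneStreamComputable.exists_bits`).

This is applied to the words `d d d ⋯`, where `d` is a binary De Bruijn cycle of order `k`.  There
are at least `2 ^ (2 ^ k / 8)` cycles (`DeBruijn.exists_finset`).  They come from Eulerian circuits
of the De Bruijn graph: fix for every vertex the edge by which it is left for the last time, in such
a way that these edges lead from everywhere to the zero vertex, and walk greedily, using the fixed
edge of a vertex only when the other one has been taken.  The walk is an Eulerian circuit and it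
determines the fixed edges.  The edges that append `0` have the required property, and they still
have it after arbitrary changes at the vertices ending in `01`, a quarter of all vertices.

If `2 ^ k` is large compared with `(m + 1) p`, counting pairs of a cycle and a block shows that for
some cycle, which can also be chosen incompressible with respect to a given `D`, half of the blocks
cause output of a length proportional to `2 ^ k` each, so the code word has linear length
(`exists_incompressible_cycle`).  On the other hand, in `d d d ⋯` every word of length `k` is always
followed by the same letter, so that the modified entropy consists of one logarithmic charge for
each of `2 ^ k` words (`length_mul_modEntropy_periodicWord_le`).

The impossibility of an entropy-only bound follows with `k = c (⌊log log n⌋ + 1)` for a large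
constant `c`: then `2 ^ k` is polylogarithmic but exceeds `(m + 1) p`, the entropy term is
polylogarithmic, and `g_k` is at most the square root of `n`.
-/

/-! ### Runs of a machine and their traces over a block of cells -/

namespace StreamMachine

variable {α : Type*} {M : StreamMachine α}

theorem next_eq_some_iff {c c' : M.Config} :
    M.next c = some c' ↔ ∃ q x mv o,
      M.step c.mem (c.tape c.head) = some (q, x, mv, o) ∧ c' = c.update q x mv o := by
  unfold next
  rw [Option.map_eq_some_iff]
  constructor
  · rintro ⟨⟨q, x, mv, o⟩, h, rfl⟩
    exact ⟨q, x, mv, o, h, rfl⟩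
  · rintro ⟨q, x, mv, o, h, rfl⟩
    exact ⟨_, h, rfl⟩

theorem next_eq_none_iff {c : M.Config} :
    M.next c = none ↔ M.step c.mem (c.tape c.head) = none := by
  simp [next]

/-- `HaltingRun c l f`: started in `c`, the machine passes through the configurations `l` and
halts in `f`, the last entry of `c :: l`. -/
inductive HaltingRun : M.Config → List M.Config → M.Config → Prop
  | halt {c : M.Config} : M.next c = none → HaltingRun c [] c
  | step {c c' f : M.Config} {l : List M.Config} :
      M.next c = some c' → HaltingRun c' l f → HaltingRun c (c' :: l) f

theorem HaltsIn.exists_run {s : List α} {f : M.Config} (h : M.HaltsIn s f) :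
    ∃ l, HaltingRun (M.init s) l f := by
  obtain ⟨h, hf⟩ := h
  generalize M.init s = c at h
  induction h using Relation.ReflTransGen.head_induction_on with
  | refl => exact ⟨[], .halt hf⟩
  | head h _ ih =>
    obtain ⟨l, hl⟩ := ih
    exact ⟨_, .step h hl⟩

theorem HaltsIn.unique {s : List α} {f f' : M.Config} (h : M.HaltsIn s f)
    (h' : M.HaltsIn s f') : f = f' := by
  have key : ∀ {g g' : M.Config}, Relation.ReflTransGen (fun a b => M.next a = some b) g g' →
      M.next g = none → g = g' := by
    intro g g' hg hn
    rcases hg.cases_head with h | ⟨c, hc, -⟩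
    · exact h
    · simp [hn] at hc
  have hu : Relator.RightUnique (fun a b : M.Config => M.next a = some b) := by
    intro a b c hb hc
    simpa [hb] using hc
  rcases Relation.ReflTransGen.total_of_right_unique hu h.1 h'.1 with h1 | h1
  · exact key h1 h.2
  · exact (key h1 h'.2).symm

/-- An event in the trace over a block: a bit emitted while the head is in the block, or a
crossing of the border of the block, recorded with the memory after the crossing and with the
direction of the crossing (`true` for rightward). -/
abbrev Event (M : StreamMachine α) : Type := Bool ⊕ M.Mem × Bool

/-- The events of the step from `c` to `c'` with respect to the block of cells `a, …, b - 1`. -/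
noncomputable def events (a b : ℤ) (c c' : M.Config) : List M.Event :=
  (if c.head ∈ Set.Ico a b then (c'.output.drop c.output.length).map Sum.inl else []) ++
    if (c.head ∈ Set.Ico a b ↔ c'.head ∈ Set.Ico a b) then [] else [Sum.inr (c'.mem, c'.rightward)]

/-- The sequence of all events of a run with respect to the block of cells `a, …, b - 1`. -/
noncomputable def trace (a b : ℤ) : M.Config → List M.Config → List M.Event
  | _, [] => []
  | c, c' :: l => events a b c c' ++ trace a b c' l

theorem exists_output_eq_append {c c' : M.Config} (h : M.next c = some c') :
    ∃ o, c'.output = c.output ++ o := by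
  obtain ⟨q, x, mv, o, -, rfl⟩ := next_eq_some_iff.1 h
  exact ⟨o, rfl⟩

theorem head_eq_of_exit {a b : ℤ} {c c' : M.Config} (h : M.next c = some c')
    (hc : c.head ∈ Set.Ico a b) (hc' : c'.head ∉ Set.Ico a b) :
    c'.head = if c'.rightward then b else a - 1 := by
  obtain ⟨q, x, mv, o, -, rfl⟩ := next_eq_some_iff.1 h
  cases mv <;> simp only [Config.update, Set.mem_Ico, if_true] at * <;> grind

theorem head_eq_of_enter {a b : ℤ} {c c' : M.Config} (h : M.next c = some c')
    (hc : c.head ∉ Set.Ico a b) (hc' : c'.head ∈ Set.Ico a b) :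
    c'.head = if c'.rightward then a else b - 1 := by
  obtain ⟨q, x, mv, o, -, rfl⟩ := next_eq_some_iff.1 h
  cases mv <;> simp only [Config.update, Set.mem_Ico, if_true] at * <;> grind

/-- `PathIn P c c'`: the machine gets from `c` to `c'` by steps that all start with the head in
`P`. -/
def PathIn (P : Set ℤ) : M.Config → M.Config → Prop :=
  Relation.ReflTransGen fun c c' => c.head ∈ P ∧ M.next c = some c'

/-- A run that starts inside the block either halts there or has a first exit; the trace up to
that moment consists of the bits emitted meanwhile. -/
theorem HaltingRun.split_inside {a b : ℤ} {c f : M.Config} {l : List M.Config}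
    (h : HaltingRun c l f) (hc : c.head ∈ Set.Ico a b) :
    (∃ o, trace a b c l = o.map Sum.inl ∧ f.output = c.output ++ o ∧
      PathIn (Set.Ico a b) c f ∧ f.head ∈ Set.Ico a b ∧ M.next f = none) ∨
    ∃ o c' l', PathIn (Set.Ico a b) c c' ∧ c'.head ∉ Set.Ico a b ∧
      (c'.head = if c'.rightward then b else a - 1) ∧ HaltingRun c' l' f ∧
      l'.length < l.length ∧ c'.output = c.output ++ o ∧
      trace a b c l = o.map Sum.inl ++ Sum.inr (c'.mem, c'.rightward) :: trace a b c' l' := by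
  induction h with
  | halt hn => exact .inl ⟨[], rfl, by simp, .refl, hc, hn⟩
  | @step c c' f l hn hr ih =>
    obtain ⟨o, ho⟩ := exists_output_eq_append hn
    by_cases hc' : c'.head ∈ Set.Ico a b
    · have hev : events a b c c' = o.map Sum.inl := by simp [events, hc, hc', ho]
      rcases ih hc' with ⟨o', h1, h2, h3, h4⟩ | ⟨o', c'', l', h1, h2, h3, h4, h5, h6, h7⟩
      · refine .inl ⟨o ++ o', ?_, ?_, .head ⟨hc, hn⟩ h3, h4⟩
        · simp [trace, hev, h1]
        · simp [h2, ho]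
      · refine .inr ⟨o ++ o', c'', l', .head ⟨hc, hn⟩ h1, h2, h3, h4, ?_, ?_, ?_⟩
        · simp only [List.length_cons]; omega
        · simp [h6, ho]
        · simp [trace, hev, h7]
    · refine .inr ⟨o, c', l, .single ⟨hc, hn⟩, hc', head_eq_of_exit hn hc hc', hr, by simp, ho, ?_⟩
      simp only [trace, events, if_pos hc, ho]
      simp [hc, hc']

/-- A run that starts outside the block either never enters it or has a first entry; nothing is
recorded before. -/
theorem HaltingRun.split_outside {a b : ℤ} {c f : M.Config} {l : List M.Config}
    (h : HaltingRun c l f) (hc : c.head ∉ Set.Ico a b) :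
    (trace a b c l = [] ∧ PathIn (Set.Ico a b)ᶜ c f ∧ f.head ∉ Set.Ico a b ∧ M.next f = none) ∨
    ∃ c' l', PathIn (Set.Ico a b)ᶜ c c' ∧ c'.head ∈ Set.Ico a b ∧
      (c'.head = if c'.rightward then a else b - 1) ∧ HaltingRun c' l' f ∧
      l'.length < l.length ∧
      trace a b c l = Sum.inr (c'.mem, c'.rightward) :: trace a b c' l' := by
  induction h with
  | halt hn => exact .inl ⟨rfl, .refl, hc, hn⟩
  | @step c c' f l hn hr ih =>
    by_cases hc' : c'.head ∈ Set.Ico a b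
    · refine .inr ⟨c', l, .single ⟨hc, hn⟩, hc', head_eq_of_enter hn hc hc', hr, by simp, ?_⟩
      simp only [trace, events, if_neg hc]
      simp [hc, hc']
    · have hev : events a b c c' = [] := by
        simp only [events, if_neg hc]
        simp [hc, hc']
      rcases ih hc' with ⟨h1, h2, h3⟩ | ⟨c'', l', h1, h2, h3, h4, h5, h6⟩
      · exact .inl ⟨by simp [trace, hev, h1], .head ⟨hc, hn⟩ h2, h3⟩
      · refine .inr ⟨c'', l', .head ⟨hc, hn⟩ h1, h2, h3, h4, ?_, by simp [trace, hev, h6]⟩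
        simp only [List.length_cons]; omega

/-- While the head stays in `P`, only the memory, the position of the head and the cells in `P`
matter: a configuration `h` that agrees with `c` in these follows a path of `c` in `P`. -/
theorem PathIn.mirror {P : Set ℤ} {c c' : M.Config} (hp : PathIn P c c') {h : M.Config}
    (hm : h.mem = c.mem) (hh : h.head = c.head) (ht : Set.EqOn h.tape c.tape P) :
    ∃ h' o, Relation.ReflTransGen (fun a b => M.next a = some b) h h' ∧
      h'.mem = c'.mem ∧ h'.head = c'.head ∧ Set.EqOn h'.tape c'.tape P ∧
      Set.EqOn h'.tape h.tape Pᶜ ∧ Set.EqOn c'.tape c.tape Pᶜ ∧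
      c'.output = c.output ++ o ∧ h'.output = h.output ++ o := by
  induction hp with
  | refl => exact ⟨h, [], .refl, hm, hh, ht, fun _ _ => rfl, fun _ _ => rfl, by simp, by simp⟩
  | @tail c1 c2 _ hs ih =>
    obtain ⟨h1, o1, r1, r2, r3, r4, r5, r6, r7, r8⟩ := ih
    obtain ⟨hP, hn⟩ := hs
    obtain ⟨q, x, mv, o, hst, rfl⟩ := next_eq_some_iff.1 hn
    refine ⟨h1.update q x mv o, o1 ++ o, r1.tail (next_eq_some_iff.2 ⟨q, x, mv, o, ?_, rfl⟩), rfl,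
      ?_, ?_, ?_, ?_, ?_, ?_⟩
    · rw [r2, r3, r4 hP, hst]
    · simp only [Config.update, r3]
    · intro i hi
      simp only [Config.update, r3, Function.update_apply]
      split_ifs
      · rfl
      · exact r4 hi
    · intro i hi
      have : i ≠ c1.head := fun e => hi (e ▸ hP)
      simpa [Config.update, r3, Function.update_apply, this] using r5 hi
    · intro i hi
      have : i ≠ c1.head := fun e => hi (e ▸ hP)
      simpa [Config.update, Function.update_apply, this] using r6 hi
    · simp [Config.update, r7]
    · simp [Config.update, r8]

theorem map_inl_ne_append_inr {β γ : Type*} {o o' : List β} {y : γ} {τ : List (β ⊕ γ)} :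
    o.map Sum.inl ≠ o'.map Sum.inl ++ Sum.inr y :: τ := by
  intro h
  have : (Sum.inr y : β ⊕ γ) ∈ o.map Sum.inl := by rw [h]; simp
  simp at this

theorem map_inl_append_inr_inj {β γ : Type*} {o o' : List β} {y y' : γ} {τ τ' : List (β ⊕ γ)}
    (h : o.map Sum.inl ++ Sum.inr y :: τ = o'.map Sum.inl ++ Sum.inr y' :: τ') :
    o = o' ∧ y = y' ∧ τ = τ' := by
  induction o generalizing o' with
  | nil =>
    cases o' with
    | nil => simpa using h
    | cons b o' => simp at h
  | cons b o ih =>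
    cases o' with
    | nil => simp at h
    | cons b' o' =>
      simp only [List.map_cons, List.cons_append, List.cons.injEq, Sum.inl.injEq] at h
      obtain ⟨h1, h2, h3⟩ := ih h.2
      exact ⟨by rw [h.1, h1], h2, h3⟩

/-- Cut and paste: if two runs, from `c` and from `e`, leave the same trace over a block, then the
hybrid configuration `h`, which agrees with `e` on the block and with `c` elsewhere, leads to the
same final output as `c`. -/
theorem HaltingRun.exists_hybrid {a b : ℤ} {c f e g : M.Config} {l l' : List M.Config}
    (hc : HaltingRun c l f) (he : HaltingRun e l' g) (htr : trace a b c l = trace a b e l')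
    (hce : c.head ∈ Set.Ico a b ↔ e.head ∈ Set.Ico a b) {h : M.Config}
    (hmem : h.mem = c.mem) (hhead : h.head = c.head) (hout : h.output = c.output)
    (htape : Set.EqOn h.tape c.tape (Set.Ico a b)ᶜ) (htape' : Set.EqOn h.tape e.tape (Set.Ico a b))
    (hmem' : c.head ∈ Set.Ico a b → e.mem = h.mem)
    (hhead' : c.head ∈ Set.Ico a b → e.head = h.head) :
    ∃ h', Relation.ReflTransGen (fun a b => M.next a = some b) h h' ∧ M.next h' = none ∧
      h'.output = f.output := by
  induction hl : l.length using Nat.strong_induction_on generalizing c e h l l' with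
  | _ N ih =>
  subst hl
  by_cases hin : c.head ∈ Set.Ico a b
  · have hin' := hce.1 hin
    rcases hc.split_inside hin with ⟨o, t1, t2, t3, t4, t5⟩ |
      ⟨o, c1, l1, t1, t2, t3, t4, t5, t6, t7⟩
    · rcases he.split_inside hin' with ⟨o', u1, u2, u3, u4, u5⟩ |
        ⟨o', e1, l1', u1, u2, u3, u4, u5, u6, u7⟩
      · obtain rfl : o = o' := by
          rw [t1, u1] at htr
          exact List.map_injective_iff.2 Sum.inl_injective htr
        obtain ⟨h', o1, v1, v2, v3, v4, v5, v6, v7, v8⟩ :=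
          u3.mirror (hmem' hin).symm (hhead' hin).symm htape'
        refine ⟨h', v1, ?_, ?_⟩
        · rw [next_eq_none_iff] at u5 ⊢
          rw [v2, v3, v4 u4, u5]
        · rw [u2] at v7
          rw [v8, t2, ← List.append_cancel_left v7, hout]
      · rw [t1, u7] at htr
        exact absurd htr map_inl_ne_append_inr
    · rcases he.split_inside hin' with ⟨o', u1, u2, u3, u4, u5⟩ |
        ⟨o', e1, l1', u1, u2, u3, u4, u5, u6, u7⟩
      · rw [t7, u1] at htr
        exact absurd htr.symm map_inl_ne_append_inr
      · rw [t7, u7] at htr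
        obtain ⟨rfl, hcr, htr'⟩ := map_inl_append_inr_inj htr
        obtain ⟨hcm, hcd⟩ := Prod.mk.inj hcr
        obtain ⟨h', o1, v1, v2, v3, v4, v5, v6, v7, v8⟩ :=
          u1.mirror (hmem' hin).symm (hhead' hin).symm htape'
        obtain ⟨-, -, -, -, -, -, -, w6, -, -⟩ := t1.mirror rfl rfl (fun _ _ => rfl)
        obtain ⟨h'', y1, y2, y3⟩ := ih _ t5 t4 u4 htr' (by simp [t2, u2]) (h := h')
          (by rw [v2, hcm]) (by rw [v3, t3, u3, hcd])
          (by rw [u6] at v7; rw [v8, t6, hout, List.append_cancel_left v7])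
          (fun i hi => by rw [v5 hi, htape hi, w6 hi]) v4
          (fun hh => absurd hh t2) (fun hh => absurd hh t2) rfl
        exact ⟨h'', v1.trans y1, y2, y3⟩
  · have hin' : e.head ∉ Set.Ico a b := fun hh => hin (hce.2 hh)
    rcases hc.split_outside hin with ⟨t1, t2, t3, t4⟩ | ⟨c1, l1, t1, t2, t3, t4, t5, t6⟩
    · obtain ⟨h', o1, v1, v2, v3, v4, v5, v6, v7, v8⟩ := t2.mirror hmem hhead htape
      refine ⟨h', v1, ?_, by rw [v8, v7, hout]⟩
      rw [next_eq_none_iff] at t4 ⊢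
      rw [v2, v3, v4 t3, t4]
    · rcases he.split_outside hin' with ⟨u1, u2, u3, u4⟩ | ⟨e1, l1', u1, u2, u3, u4, u5, u6⟩
      · rw [t6, u1] at htr
        simp at htr
      · rw [t6, u6] at htr
        simp only [List.cons.injEq, Sum.inr.injEq, Prod.mk.injEq] at htr
        obtain ⟨⟨hcm, hcd⟩, htr'⟩ := htr
        obtain ⟨h', o1, v1, v2, v3, v4, v5, v6, v7, v8⟩ := t1.mirror hmem hhead htape
        obtain ⟨-, -, -, -, -, -, -, w6, -, -⟩ := u1.mirror rfl rfl (fun _ _ => rfl)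
        rw [compl_compl] at v5 w6
        obtain ⟨h'', y1, y2, y3⟩ := ih _ t5 t4 u4 htr' (by simp only [t2, u2]) (h := h')
          v2 v3 (by rw [v8, v7, hout]) v4
          (fun i hi => by rw [v5 hi, htape' hi, w6 hi])
          (fun _ => by rw [v2, hcm]) (fun _ => by rw [v3, t3, u3, hcd]) rfl
        exact ⟨h'', v1.trans y1, y2, y3⟩

/-- The number of borders of the block that a head at `h` can still cross without changing its
direction. -/
noncomputable def crossingsAhead (a b h : ℤ) (rightward : Bool) : ℕ :=
  if h ∈ Set.Ico a b then 1 else if (h < a ↔ rightward = true) then 2 else 0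

theorem countP_isRight_events_le {a b : ℤ} (hab : a < b) {c c' : M.Config}
    (h : M.next c = some c') :
    (events a b c c').countP Sum.isRight + 2 * c.reversals +
      crossingsAhead a b c'.head c'.rightward ≤
      2 * c'.reversals + crossingsAhead a b c.head c.rightward := by
  have h1 : (events a b c c').countP Sum.isRight =
      if (c.head ∈ Set.Ico a b ↔ c'.head ∈ Set.Ico a b) then 0 else 1 := by
    unfold events
    rw [List.countP_append]
    have : ∀ o : List Bool, (o.map (Sum.inl : Bool → M.Event)).countP Sum.isRight = 0 := by
      intro o; simp [List.countP_map, Function.comp_def]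
    split_ifs <;> simp only [this, List.countP_nil, List.countP_singleton, Sum.isRight_inr, if_true,
      add_zero, zero_add]
  rw [h1]
  obtain ⟨q, x, mv, o, -, rfl⟩ := next_eq_some_iff.1 h
  cases mv <;> cases hr : c.rightward <;>
    simp only [Config.update, crossingsAhead, Set.mem_Ico, hr, iff_true, reduceCtorEq, iff_false] <;>
    split_ifs <;> omega

/-- The number of crossings of the border of a block is governed by the number of reversals. -/
theorem HaltingRun.countP_isRight_trace_le {a b : ℤ} (hab : a < b) {c f : M.Config}
    {l : List M.Config} (h : HaltingRun c l f) :
    (trace a b c l).countP Sum.isRight + 2 * c.reversals ≤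
      2 * f.reversals + crossingsAhead a b c.head c.rightward := by
  induction h with
  | halt => simp [trace]
  | @step c c' f l hn hr ih =>
    have := countP_isRight_events_le hab hn
    simp only [trace, List.countP_append]
    omega

/-- The bits emitted over disjoint blocks are all part of the output. -/
theorem HaltingRun.sum_countP_isLeft_trace_le {ι : Type*} {t : Finset ι} {a b : ι → ℤ}
    (hd : ∀ i ∈ t, ∀ j ∈ t, ∀ x, x ∈ Set.Ico (a i) (b i) → x ∈ Set.Ico (a j) (b j) → i = j)
    {c f : M.Config} {l : List M.Config} (h : HaltingRun c l f) :
    ∑ i ∈ t, (trace (a i) (b i) c l).countP Sum.isLeft + c.output.length ≤ f.output.length := by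
  induction h with
  | halt => simp [trace]
  | @step c c' f l hn hr ih =>
    obtain ⟨o, ho⟩ := exists_output_eq_append hn
    have hev : ∀ i, (events (a i) (b i) c c').countP Sum.isLeft =
        if c.head ∈ Set.Ico (a i) (b i) then o.length else 0 := by
      intro i
      unfold events
      rw [List.countP_append]
      split_ifs <;> simp [ho]
    have hsum : ∑ i ∈ t, (events (a i) (b i) c c').countP Sum.isLeft ≤ o.length := by
      simp only [hev]
      by_cases hex : ∃ i ∈ t, c.head ∈ Set.Ico (a i) (b i)
      · obtain ⟨i, hi, hci⟩ := hex
        rw [Finset.sum_eq_single_of_mem i hi]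
        · simp [hci]
        · intro j hj hne
          exact if_neg fun hcj => hne (hd j hj i hi _ hcj hci)
      · push Not at hex
        rw [Finset.sum_eq_zero fun i hi => if_neg (hex i hi)]
        exact Nat.zero_le _
    simp only [trace, List.countP_append, Finset.sum_add_distrib]
    rw [ho, List.length_append] at ih
    omega

end StreamMachine

/-! ### Binary codes of traces, and counting -/

theorem card_lt_of_length_le {S : Finset (List Bool)} {W : ℕ} (h : ∀ l ∈ S, l.length ≤ W) :
    S.card < 2 ^ (W + 1) := by
  have hsub : S ⊆ (Finset.range (W + 1)).biUnion
      fun i => (Finset.univ : Finset (Fin i → Bool)).image List.ofFn := by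
    intro l hl
    simp only [Finset.mem_biUnion, Finset.mem_range, Finset.mem_image, Finset.mem_univ, true_and]
    exact ⟨l.length, by have := h l hl; omega, l.get, List.ofFn_get l⟩
  calc S.card ≤ _ := Finset.card_le_card hsub
    _ ≤ ∑ i ∈ Finset.range (W + 1), 2 ^ i := by
        refine Finset.card_biUnion_le.trans (Finset.sum_le_sum fun i _ => ?_)
        exact Finset.card_image_le.trans (by simp)
    _ < 2 ^ (W + 1) := by
        have := Nat.geomSum_eq (le_refl 2) (W + 1)
        have h2 : 0 < 2 ^ (W + 1) := by positivity
        rw [this]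
        simp only [Nat.add_one_sub_one, Nat.div_one]
        omega

namespace StreamMachine

variable {α : Type*} {M : StreamMachine α}

/-- A prefix code for events: two bits for an emitted bit, `m + 2` bits for a crossing. -/
def encodeEvent {m : ℕ} (e : M.Mem → Fin m → Bool) : M.Event → List Bool
  | .inl b => [true, b]
  | .inr (q, r) => false :: r :: List.ofFn (e q)

theorem flatMap_encodeEvent_injective {m : ℕ} {e : M.Mem → Fin m → Bool}
    (he : Function.Injective e) :
    Function.Injective fun τ : List M.Event => τ.flatMap (encodeEvent e) := by
  intro τ
  induction τ with
  | nil =>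
    rintro (_ | ⟨b | ⟨q, r⟩, τ'⟩) h
    · rfl
    · simp [encodeEvent] at h
    · simp [encodeEvent] at h
  | cons x τ ih =>
    rintro (_ | ⟨y, τ'⟩) h
    · rcases x with b | ⟨q, r⟩ <;> simp [encodeEvent] at h
    · simp only [List.flatMap_cons] at h
      rcases x with b | ⟨q, r⟩ <;> rcases y with b' | ⟨q', r'⟩ <;>
        simp only [encodeEvent, List.cons_append, List.nil_append, List.cons.injEq, reduceCtorEq,
          false_and, true_and] at h
      · rw [h.1, ih h.2]
      · obtain ⟨h1, h2⟩ := h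
        obtain ⟨h3, h4⟩ := List.append_inj h2 (by simp)
        rw [h1, he (List.ofFn_injective h3), ih h4]

theorem length_flatMap_encodeEvent {m : ℕ} (e : M.Mem → Fin m → Bool) (τ : List M.Event) :
    (τ.flatMap (encodeEvent e)).length =
      2 * τ.countP Sum.isLeft + τ.countP Sum.isRight * (m + 2) := by
  induction τ with
  | nil => simp
  | cons x τ ih =>
    rcases x with b | ⟨q, r⟩ <;> simp [encodeEvent, ih, List.countP_cons] <;> ring

end StreamMachine

/-- What a compressor with one stream, `m` bits of memory and `p` passes reveals of the `i`-th
block of `K` input letters: a code word, short if few bits are emitted over the block, that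
determines the block in the context of the other blocks.  The bits emitted over the blocks are all
part of the output. -/
theorem OneStreamComputable.exists_block_code {α : Type*} {C : List α → List Bool} {m p : ℕ → ℕ}
    (hC : OneStreamComputable C m p) (n : ℕ) {K : ℕ} (hK : 0 < K) :
    ∃ (code : ℕ → List α → List Bool) (bits : ℕ → List α → ℕ),
      (∀ i s, s.length = n → (code i s).length ≤ 2 * bits i s + 2 * p n * (m n + 2)) ∧
      (∀ N s, s.length = n → ∑ i ∈ Finset.range N, bits i s ≤ (C s).length) ∧
      ∀ i s s' h, s.length = n → s'.length = n → h.length = n → code i s = code i s' →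
        (∀ j, h[j]? = if i * K ≤ j ∧ j < (i + 1) * K then s'[j]? else s[j]?) → C h = C s := by
  classical
  obtain ⟨M, hM, hrun⟩ := hC n
  let _ := M.fintypeMem
  obtain ⟨e⟩ : Nonempty (M.Mem ↪ (Fin (m n) → Bool)) :=
    Function.Embedding.nonempty_of_card_le (by simpa using hM)
  have hex : ∀ s : List α, ∃ (l : List M.Config) (f : M.Config), s.length = n →
      StreamMachine.HaltingRun (M.init s) l f ∧ M.HaltsIn s f ∧ f.output = C s ∧
        f.reversals + 1 ≤ p n := by
    intro s
    by_cases hs : s.length = n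
    · obtain ⟨f, h1, h2, h3⟩ := hrun s hs
      obtain ⟨l, hl⟩ := h1.exists_run
      exact ⟨l, f, fun _ => ⟨hl, h1, h2, h3⟩⟩
    · exact ⟨[], M.init s, fun h => absurd h hs⟩
  choose l f hlf using hex
  let τ : ℕ → List α → List M.Event := fun i s =>
    StreamMachine.trace (i * K : ℤ) ((i + 1) * K : ℤ) (M.init s) (l s)
  refine ⟨fun i s => (τ i s).flatMap (StreamMachine.encodeEvent e),
    fun i s => (τ i s).countP Sum.isLeft, ?_, ?_, ?_⟩
  · intro i s hs
    obtain ⟨h1, h2, h3, h4⟩ := hlf s hs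
    have hKi : (i * K : ℤ) < (i + 1) * K := by
      have : (0 : ℤ) < K := by exact_mod_cast hK
      linarith
    have hcr := h1.countP_isRight_trace_le hKi
    have hphi : StreamMachine.crossingsAhead (i * K : ℤ) ((i + 1) * K) (M.init s).head
        (M.init s).rightward ≤ 2 := by
      unfold StreamMachine.crossingsAhead
      split_ifs <;> omega
    rw [StreamMachine.length_flatMap_encodeEvent]
    have : (τ i s).countP Sum.isRight ≤ 2 * p n := by
      simp only [StreamMachine.init, mul_zero, add_zero] at hcr hphi
      have h5 : (τ i s).countP Sum.isRight ≤ _ := hcr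
      omega
    exact Nat.add_le_add_left (Nat.mul_le_mul_right (m n + 2) this) _
  · intro N s hs
    obtain ⟨h1, h2, h3, h4⟩ := hlf s hs
    have := h1.sum_countP_isLeft_trace_le (t := Finset.range N) (a := fun i => (i * K : ℤ))
      (b := fun i => ((i + 1) * K : ℤ)) (by
        intro i _ j _ x hx hy
        simp only [Set.mem_Ico] at hx hy
        have hK' : (0 : ℤ) < K := by exact_mod_cast hK
        have h1 : (i : ℤ) < j + 1 := lt_of_mul_lt_mul_right (hx.1.trans_lt hy.2) hK'.le
        have h2 : (j : ℤ) < i + 1 := lt_of_mul_lt_mul_right (hy.1.trans_lt hx.2) hK'.le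
        omega)
    rw [h3] at this
    exact le_of_add_le_left this
  · intro i s s' h hs hs' hh hcode hhyb
    obtain ⟨h1, h2, h3, h4⟩ := hlf s hs
    obtain ⟨h1', -, -, -⟩ := hlf s' hs'
    obtain ⟨-, h2h, h3h, -⟩ := hlf h hh
    have htr : τ i s = τ i s' := StreamMachine.flatMap_encodeEvent_injective e.injective hcode
    have hmem : ∀ x : ℤ, ¬ x < 0 →
        (x ∈ Set.Ico (i * K : ℤ) ((i + 1) * K) ↔
          i * K ≤ x.toNat ∧ x.toNat < (i + 1) * K) := by
      intro x hx
      lift x to ℕ using by omega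
      simp only [Set.mem_Ico, Int.toNat_natCast]
      norm_cast
    obtain ⟨g, hg1, hg2, hg3⟩ := h1.exists_hybrid h1' htr Iff.rfl (h := M.init h) rfl rfl rfl
      (by
        intro x hx
        simp only [StreamMachine.init, StreamMachine.initTape]
        split_ifs with hx0
        · rfl
        · rw [Set.mem_compl_iff, hmem x hx0] at hx
          rw [hhyb, if_neg hx])
      (by
        intro x hx
        simp only [StreamMachine.init, StreamMachine.initTape]
        split_ifs with hx0
        · rfl
        · rw [hmem x hx0] at hx
          rw [hhyb, if_pos hx])
      (fun _ => rfl) (fun _ => rfl)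
    rw [← h3h, h2h.unique ⟨hg1, hg2⟩, hg3, h3]

/-- The prefix of length `n` of `d d d ⋯`, written with the letters `φ false` and `φ true`. -/
def periodicWord {α : Type*} (φ : Bool → α) (n : ℕ) (d : List Bool) : List α :=
  (List.range n).map fun j => φ (d.getD (j % d.length) false)

@[simp]
theorem length_periodicWord {α : Type*} (φ : Bool → α) (n : ℕ) (d : List Bool) :
    (periodicWord φ n d).length = n := by
  simp [periodicWord]

theorem getElem?_periodicWord {α : Type*} (φ : Bool → α) (n : ℕ) (d : List Bool) (j : ℕ) :
    (periodicWord φ n d)[j]? = if j < n then some (φ (d.getD (j % d.length) false)) else none := by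
  unfold periodicWord
  rw [List.getElem?_map]
  split_ifs with h <;> simp [h]

/-- Over any fixed block, only few of the periodic words cause little output. -/
theorem OneStreamComputable.exists_bits {α : Type*} {C : List α → List Bool} {m p : ℕ → ℕ}
    (hC : OneStreamComputable C m p) (hinj : Function.Injective C) {φ : Bool → α}
    (hφ : Function.Injective φ) (n : ℕ) {K : ℕ} (hK : 0 < K) :
    ∃ bits : ℕ → List Bool → ℕ,
      (∀ d, ∑ i ∈ Finset.range (n / K), bits i d ≤ (C (periodicWord φ n d)).length) ∧
      ∀ (A : Finset (List Bool)) (L i : ℕ), (∀ d ∈ A, d.length = K) → i < n / K →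
        (∀ d ∈ A, bits i d ≤ L) → A.card < 2 ^ (2 * L + 2 * p n * (m n + 2) + 1) := by
  obtain ⟨code, bits, h1, h2, h3⟩ := hC.exists_block_code n hK
  refine ⟨fun i d => bits i (periodicWord φ n d), fun d => h2 _ _ (by simp), ?_⟩
  intro A L i hA hi hL
  have hiK : (i + 1) * K ≤ n := (Nat.mul_le_mul_right K hi).trans (Nat.div_mul_le_self n K)
  have hcinj : Set.InjOn (fun d => code i (periodicWord φ n d)) A := by
    intro d hd d' hd' hdd
    have hdl := hA d hd
    have hdl' := hA d' hd'
    set h : List α := (List.range n).map fun j =>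
      φ ((if i * K ≤ j ∧ j < (i + 1) * K then d' else d).getD (j % K) false) with hh
    have hhj : ∀ j, h[j]? = if i * K ≤ j ∧ j < (i + 1) * K then (periodicWord φ n d')[j]?
        else (periodicWord φ n d)[j]? := by
      intro j
      rw [getElem?_periodicWord, getElem?_periodicWord, hh, List.getElem?_map, hdl, hdl']
      by_cases hj : j < n
      · rw [List.getElem?_range hj]
        simp only [Option.map_some, hj, if_true]
        split_ifs <;> rfl
      · have : (List.range n)[j]? = none := by simp; omega
        rw [this]
        simp [hj]
    have heq : h = periodicWord φ n d :=
      hinj (h3 i _ _ h (by simp) (by simp) (by simp [hh]) hdd hhj)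
    refine List.ext_getElem (by rw [hdl, hdl']) fun r hr hr' => ?_
    have hrK : r < K := hdl ▸ hr
    have h4 := hhj (i * K + r)
    have hlt : i * K + r < (i + 1) * K := by linarith
    rw [heq, if_pos ⟨by omega, hlt⟩, getElem?_periodicWord, getElem?_periodicWord,
      if_pos (by omega), if_pos (by omega), hdl, hdl', Nat.mul_add_mod_of_lt hrK] at h4
    have h5 := hφ (Option.some.inj h4)
    rwa [List.getD_eq_getElem _ _ hr, List.getD_eq_getElem _ _ hr'] at h5
  rw [← Finset.card_image_of_injOn hcinj]
  refine card_lt_of_length_le fun l hl => ?_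
  obtain ⟨d, hd, rfl⟩ := Finset.mem_image.1 hl
  have := h1 i (periodicWord φ n d) (by simp)
  have := hL d hd
  dsimp only at *
  omega

/-! ### De Bruijn cycles from last-exit rules -/

namespace DeBruijn

variable {m : ℕ}

/-- The vertex reached from `v` in the De Bruijn graph by appending `b`. -/
def shift (v : Fin (m + 1) → Bool) (b : Bool) : Fin (m + 1) → Bool :=
  Fin.tail (Fin.snoc (α := fun _ => Bool) v b)

/-- One step of the greedy walk with last-exit rule `f`.  A state consists of the set of the
vertices that have been left before, and the present vertex `v`.  The walk leaves `v` along the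
edge that the rule does not choose on the first occasion, and along the chosen edge afterwards. -/
def walkStep (f : (Fin (m + 1) → Bool) → Bool)
    (s : Finset (Fin (m + 1) → Bool) × (Fin (m + 1) → Bool)) :
    Finset (Fin (m + 1) → Bool) × (Fin (m + 1) → Bool) :=
  (insert s.2 s.1, shift s.2 (if s.2 ∈ s.1 then f s.2 else !f s.2))

/-- The walk of a last-exit rule, started in the zero vertex. -/
def walk (f : (Fin (m + 1) → Bool) → Bool) (t : ℕ) :
    Finset (Fin (m + 1) → Bool) × (Fin (m + 1) → Bool) :=
  (walkStep f)^[t] (∅, fun _ => false)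

/-- The vertex of the walk at time `t`. -/
def vert (f : (Fin (m + 1) → Bool) → Bool) (t : ℕ) : Fin (m + 1) → Bool := (walk f t).2

/-- The bit that the walk appends at time `t`. -/
def bit (f : (Fin (m + 1) → Bool) → Bool) (t : ℕ) : Bool :=
  if vert f t ∈ (walk f t).1 then f (vert f t) else !f (vert f t)

/-- The edge that the walk takes at time `t`: an edge of the De Bruijn graph is a word with one
more letter. -/
def edge (f : (Fin (m + 1) → Bool) → Bool) (t : ℕ) : Fin (m + 2) → Bool :=
  Fin.snoc (α := fun _ => Bool) (vert f t) (bit f t)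

variable {f : (Fin (m + 1) → Bool) → Bool}

theorem vert_zero : vert f 0 = fun _ => false := rfl

theorem walk_succ (t : ℕ) : walk f (t + 1) = walkStep f (walk f t) :=
  Function.iterate_succ_apply' _ _ _

theorem mem_walk_iff {t : ℕ} {v : Fin (m + 1) → Bool} :
    v ∈ (walk f t).1 ↔ ∃ t' < t, vert f t' = v := by
  induction t with
  | zero => simp [walk]
  | succ t ih =>
    rw [walk_succ]
    simp only [walkStep, Finset.mem_insert, ih]
    constructor
    · rintro (rfl | ⟨t', h, rfl⟩)
      · exact ⟨t, by omega, rfl⟩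
      · exact ⟨t', by omega, rfl⟩
    · rintro ⟨t', h, rfl⟩
      rcases Nat.lt_succ_iff_lt_or_eq.1 h with h | rfl
      · exact .inr ⟨t', h, rfl⟩
      · exact .inl rfl

theorem bit_of_first {t : ℕ} (h : ∀ t' < t, vert f t' ≠ vert f t) :
    bit f t = !f (vert f t) := by
  unfold bit
  rw [if_neg]
  rw [mem_walk_iff]
  rintro ⟨t', h1, h2⟩
  exact h t' h1 h2

theorem bit_of_not_first {t t' : ℕ} (ht : t' < t) (h : vert f t' = vert f t) :
    bit f t = f (vert f t) := by
  unfold bit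
  rw [if_pos (mem_walk_iff.2 ⟨t', ht, h⟩)]

theorem vert_succ (t : ℕ) : vert f (t + 1) = Fin.tail (edge f t) := by
  unfold vert
  rw [walk_succ]
  rfl

theorem init_edge (t : ℕ) : Fin.init (edge f t) = vert f t := by
  simp [edge]

theorem edge_last (t : ℕ) : edge f t (Fin.last _) = bit f t := by
  simp [edge]

theorem edge_eq_iff {t t' : ℕ} :
    edge f t = edge f t' ↔ vert f t = vert f t' ∧ bit f t = bit f t' := by
  unfold edge
  exact Fin.snoc_inj

theorem edge_apply (t : ℕ) (j : ℕ) (hj : j < m + 2) : edge f t ⟨j, hj⟩ = edge f (t + j) 0 := by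
  induction j generalizing t with
  | zero => rfl
  | succ j ih =>
    have h1 : edge f t ⟨j + 1, hj⟩ = Fin.tail (edge f t) ⟨j, by omega⟩ := rfl
    rw [h1, ← vert_succ, ← init_edge]
    have h2 : Fin.init (edge f (t + 1)) ⟨j, by omega⟩ = edge f (t + 1) ⟨j, by omega⟩ := rfl
    rw [h2, ih]
    congr 1
    ring

/-- The edges taken before time `T` are distinct. -/
def Fresh (f : (Fin (m + 1) → Bool) → Bool) (T : ℕ) : Prop :=
  Set.InjOn (edge f) (Set.Iio T)

/-- The vertex `v` is left twice before time `T`.  If the edges taken before `T` are distinct, this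
means that both edges out of `v` are taken. -/
def Full (f : (Fin (m + 1) → Bool) → Bool) (T : ℕ) (v : Fin (m + 1) → Bool) : Prop :=
  ∃ t₁ t₂, t₁ < t₂ ∧ t₂ < T ∧ vert f t₁ = v ∧ vert f t₂ = v

theorem Full.exists_edge {T : ℕ} {v : Fin (m + 1) → Bool} (hT : Fresh f T) (h : Full f T v)
    (b : Bool) : ∃ t < T, vert f t = v ∧ bit f t = b := by
  obtain ⟨t₁, t₂, h12, h2, hv1, hv2⟩ := h
  have hne : bit f t₁ ≠ bit f t₂ := by
    intro hb
    have := hT (show t₁ < T by omega) h2 (edge_eq_iff.2 ⟨by rw [hv1, hv2], hb⟩)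
    omega
  by_cases hb : bit f t₁ = b
  · exact ⟨t₁, by omega, hv1, hb⟩
  · refine ⟨t₂, h2, hv2, ?_⟩
    revert hb hne
    cases bit f t₁ <;> cases bit f t₂ <;> cases b <;> simp

/-- If `v` is entered twice while the edges are distinct, then both edges into `v` are taken. -/
theorem exists_edge_in {T t₁ t₂ : ℕ} {v : Fin (m + 1) → Bool} (hT : Fresh f T) (h12 : t₁ < t₂)
    (h2 : t₂ < T) (hv1 : vert f (t₁ + 1) = v) (hv2 : vert f (t₂ + 1) = v) (b : Bool) :
    ∃ t < T, edge f t = Fin.cons (α := fun _ => Bool) b v := by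
  have hne : edge f t₁ 0 ≠ edge f t₂ 0 := by
    intro hb
    have : edge f t₁ = edge f t₂ := by
      rw [← Fin.cons_self_tail (edge f t₁), ← Fin.cons_self_tail (edge f t₂), ← vert_succ,
        ← vert_succ, hv1, hv2, hb]
    have := hT (show t₁ < T by omega) h2 this
    omega
  by_cases hb : edge f t₁ 0 = b
  · exact ⟨t₁, by omega, by rw [← Fin.cons_self_tail (edge f t₁), ← vert_succ, hv1, hb]⟩
  · refine ⟨t₂, h2, ?_⟩
    have : edge f t₂ 0 = b := by
      revert hb hne
      cases edge f t₁ 0 <;> cases edge f t₂ 0 <;> cases b <;> simp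
    rw [← Fin.cons_self_tail (edge f t₂), ← vert_succ, hv2, this]

theorem exists_fresh_maximal (f : (Fin (m + 1) → Bool) → Bool) :
    ∃ T, Fresh f T ∧ ∃ t < T, edge f t = edge f T := by
  have hex : ∃ T, ¬ Fresh f T := by
    refine ⟨Fintype.card (Fin (m + 2) → Bool) + 1, fun h => ?_⟩
    have h1 : Set.InjOn (edge f) (Finset.range (Fintype.card (Fin (m + 2) → Bool) + 1)) := by
      simpa [Fresh] using h
    have h2 := Finset.card_le_card_of_injOn (t := Finset.univ) (edge f) (by simp) h1
    simp at h2
  classical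
  obtain ⟨T, hT⟩ : ∃ T, Nat.find hex = T + 1 := by
    rcases h : Nat.find hex with _ | T
    · exact absurd (fun x hx => absurd hx (by simp)) (h ▸ Nat.find_spec hex : ¬ Fresh f 0)
    · exact ⟨T, rfl⟩
  have hfr : Fresh f T := by
    by_contra hn
    have := Nat.find_min' hex hn
    omega
  refine ⟨T, hfr, ?_⟩
  by_contra hno
  push Not at hno
  have hnf : ¬ Fresh f (T + 1) := hT ▸ Nat.find_spec hex
  apply hnf
  intro x hx y hy hxy
  rcases Nat.lt_succ_iff_lt_or_eq.1 hx with hx | rfl <;>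
    rcases Nat.lt_succ_iff_lt_or_eq.1 hy with hy | rfl
  · exact hfr hx hy hxy
  · exact absurd hxy (hno _ hx)
  · exact absurd hxy.symm (hno _ hy)
  · rfl

/-- If the walk first repeats an edge at time `T`, then it is back in the zero vertex, and both
edges into this vertex have been taken: any vertex can be entered only twice up to
time `T`, but the present one has been visited three times, so one of the visits is the start. -/
theorem exists_returns {T : ℕ} (hT : Fresh f T) (hrep : ∃ t < T, edge f t = edge f T) :
    vert f T = (fun _ => false) ∧
      ∃ t₁ t₂, t₁ < t₂ ∧ t₂ < T ∧ vert f (t₁ + 1) = (fun _ => false) ∧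
        vert f (t₂ + 1) = (fun _ => false) ∧ Full f T (fun _ => false) := by
  obtain ⟨t, htT, hte⟩ := hrep
  obtain ⟨hv, hb⟩ := edge_eq_iff.1 hte
  -- the edge repeated is the rule's edge, so that `t` is not the first visit either
  have hbT : bit f T = f (vert f T) := bit_of_not_first htT hv
  obtain ⟨t', ht', hv'⟩ : ∃ t' < t, vert f t' = vert f t := by
    by_contra hno
    push Not at hno
    have := bit_of_first hno
    rw [hb, hbT, hv] at this
    simp at this
  have hthree : ∀ a b c : ℕ, a < b → b < c → c < T → vert f (a + 1) = vert f (b + 1) →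
      vert f (b + 1) = vert f (c + 1) → False := by
    intro a b c hab hbc hc h1 h2
    have key : ∀ x y, x < y → y < T → vert f (x + 1) = vert f (y + 1) →
        edge f x 0 ≠ edge f y 0 := by
      intro x y hxy hy hvv h0
      have : edge f x = edge f y := by
        rw [← Fin.cons_self_tail (edge f x), ← Fin.cons_self_tail (edge f y), ← vert_succ,
          ← vert_succ, hvv, h0]
      have := hT (show x < T by omega) hy this
      omega
    have k1 := key a b hab (by omega) h1
    have k2 := key b c hbc hc h2
    have k3 := key a c (by omega) hc (h1.trans h2)
    revert k1 k2 k3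
    cases edge f a 0 <;> cases edge f b 0 <;> cases edge f c 0 <;> simp
  obtain ⟨t, rfl⟩ : ∃ u, t = u + 1 := ⟨t - 1, by omega⟩
  obtain ⟨T, rfl⟩ : ∃ u, T = u + 1 := ⟨T - 1, by omega⟩
  rcases t' with _ | t'
  · rw [vert_zero] at hv'
    have h0 := hv.symm.trans hv'.symm
    exact ⟨h0, t, T, by omega, by omega, hv'.symm, h0, 0, t + 1, by omega, htT, vert_zero, hv'.symm⟩
  · exact (hthree t' t T (by omega) (by omega) (by omega) hv' hv).elim

/-- Last-exit edges propagate saturation backwards: if the end of the last-exit edge of `v` is left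
twice, then both edges into it are taken, this one among them, and it is taken only when `v` is
left for the second time. -/
theorem full_of_full_shift {T : ℕ} (hT : Fresh f T) (hrep : ∃ t < T, edge f t = edge f T)
    {v : Fin (m + 1) → Bool} (h : Full f T (shift v (f v))) : Full f T v := by
  obtain ⟨-, s₁, s₂, hs12, hs2, hs1v, hs2v, -⟩ := exists_returns hT hrep
  -- the last-exit edge out of `v` is taken, since both edges into its end are
  obtain ⟨t, ht, hte⟩ : ∃ t < T, edge f t = Fin.snoc (α := fun _ => Bool) v (f v) := by
    set e := Fin.snoc (α := fun _ => Bool) v (f v) with he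
    have hsh : shift v (f v) = Fin.tail e := rfl
    rw [← Fin.cons_self_tail e, ← hsh]
    by_cases h0 : shift v (f v) = fun _ => false
    · rw [h0]
      exact exists_edge_in hT hs12 hs2 hs1v hs2v _
    · obtain ⟨t₁, t₂, h12, h2, hv1, hv2⟩ := h
      have hp : ∀ u, vert f u = shift v (f v) → 0 < u := by
        intro u hu
        rcases Nat.eq_zero_or_pos u with rfl | hu0
        · exact absurd hu.symm h0
        · exact hu0
      obtain ⟨t₁, rfl⟩ : ∃ u, t₁ = u + 1 := ⟨t₁ - 1, by have := hp _ hv1; omega⟩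
      obtain ⟨t₂, rfl⟩ : ∃ u, t₂ = u + 1 := ⟨t₂ - 1, by have := hp _ hv2; omega⟩
      exact exists_edge_in hT (by omega) (by omega) hv1 hv2 _
  obtain ⟨hv, hb⟩ : vert f t = v ∧ bit f t = f v := Fin.snoc_inj.1 hte
  by_contra hno
  have hfirst : ∀ t' < t, vert f t' ≠ vert f t := fun t' ht' hvv =>
    hno ⟨t', t, ht', ht, hvv.trans hv, hv⟩
  have := bit_of_first hfirst
  rw [hb, hv] at this
  simp at this

/-- The walk of a last-exit rule that leads from every vertex to the zero vertex is an Eulerian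
circuit of the De Bruijn graph. -/
theorem eulerian (htree : ∀ v, ∃ j, (fun v => shift v (f v))^[j] v = fun _ => false) :
    Set.BijOn (edge f) (Set.Iio (2 ^ (m + 2))) Set.univ ∧
      vert f (2 ^ (m + 2)) = fun _ => false := by
  obtain ⟨T, hT, hrep⟩ := exists_fresh_maximal f
  obtain ⟨hTv, -, -, -, -, -, -, hfull⟩ := exists_returns hT hrep
  have hall : ∀ v, Full f T v := by
    intro v
    obtain ⟨j, hj⟩ := htree v
    induction j generalizing v with
    | zero =>
      rw [show v = fun _ => false from hj]
      exact hfull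
    | succ j ih =>
      exact full_of_full_shift hT hrep (ih _ hj)
  have hsurj : Set.SurjOn (edge f) (Set.Iio T) Set.univ := by
    intro e _
    obtain ⟨t, ht, hv, hb⟩ := (hall (Fin.init e)).exists_edge hT (e (Fin.last _))
    refine ⟨t, ht, ?_⟩
    rw [edge, hv, hb, Fin.snoc_init_self]
  have hbij : Set.BijOn (edge f) (Set.Iio T) Set.univ := ⟨fun _ _ => trivial, hT, hsurj⟩
  have hcard : T = 2 ^ (m + 2) := by
    have h1 := hbij.image_eq
    have h2 := hT.ncard_image
    rw [h1, Set.ncard_univ] at h2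
    simpa using h2.symm
  exact hcard ▸ ⟨hbij, hTv⟩

/-- The cyclic sequence read off the walk of a last-exit rule. -/
def cycle (f : (Fin (m + 1) → Bool) → Bool) : List Bool :=
  (List.range (2 ^ (m + 2))).map fun t => edge f t 0

@[simp]
theorem length_cycle : (cycle f).length = 2 ^ (m + 2) := by simp [cycle]

theorem take_rotate_cycle (htree : ∀ v, ∃ j, (fun v => shift v (f v))^[j] v = fun _ => false)
    {i : ℕ} (hi : i < 2 ^ (m + 2)) :
    ((cycle f).rotate i).take (m + 2) = List.ofFn (edge f i) := by
  have hlen : m + 2 ≤ 2 ^ (m + 2) := Nat.lt_two_pow_self.le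
  refine List.ext_getElem (by simp [hlen]) fun j h1 h2 => ?_
  have hj : j < m + 2 := by rwa [List.length_ofFn] at h2
  rw [List.getElem_take, List.getElem_rotate, List.getElem_ofFn]
  simp only [cycle, List.getElem_map, List.getElem_range, List.length_map, List.length_range]
  rw [edge_apply i j hj]
  by_cases hij : i + j < 2 ^ (m + 2)
  · rw [add_comm j i, Nat.mod_eq_of_lt hij]
  · -- both windows lie in the run of zeros around the starting point
    obtain ⟨r, hr⟩ : ∃ r, i + j = 2 ^ (m + 2) + r := ⟨i + j - 2 ^ (m + 2), by omega⟩
    have hrm : r < m + 1 := by omega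
    rw [add_comm j i, hr, Nat.add_mod_left, Nat.mod_eq_of_lt (by omega)]
    have key : ∀ t, vert f t = (fun _ => false) → edge f (t + r) 0 = false := by
      intro t ht
      rw [← edge_apply t r (by omega)]
      have : Fin.init (edge f t) ⟨r, hrm⟩ = false := by rw [init_edge, ht]
      exact this
    have h0 := key 0 vert_zero
    rw [zero_add] at h0
    rw [h0, key _ (eulerian htree).2]

theorem isDeBruijnCycle_cycle
    (htree : ∀ v, ∃ j, (fun v => shift v (f v))^[j] v = fun _ => false) :
    IsDeBruijnCycle (m + 2) (cycle f) := by
  intro w hw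
  obtain ⟨-, hinj, hsurj⟩ := (eulerian htree).1
  obtain ⟨e, rfl⟩ : ∃ e : Fin (m + 2) → Bool, List.ofFn e = w := by
    rw [← hw]
    exact ⟨_, List.ofFn_get w⟩
  obtain ⟨i, hi, hie⟩ := hsurj (Set.mem_univ e)
  refine ⟨i, ⟨by simpa using hi, by rw [take_rotate_cycle htree hi, hie]⟩, ?_⟩
  rintro i' ⟨hi', h⟩
  rw [length_cycle] at hi'
  rw [take_rotate_cycle htree hi'] at h
  exact hinj hi' hi ((List.ofFn_injective h).trans hie.symm)

/-- The rule can be read off the cycle: the first exit from `v` is along the other edge. -/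
theorem cycle_injOn {f g : (Fin (m + 1) → Bool) → Bool}
    (hf : ∀ v, ∃ j, (fun v => shift v (f v))^[j] v = fun _ => false)
    (hg : ∀ v, ∃ j, (fun v => shift v (g v))^[j] v = fun _ => false)
    (h : cycle f = cycle g) : f = g := by
  have hedge : ∀ t < 2 ^ (m + 2), edge f t = edge g t := by
    intro t ht
    apply List.ofFn_injective
    rw [← take_rotate_cycle hf ht, ← take_rotate_cycle hg ht, h]
  have hvert : ∀ t < 2 ^ (m + 2), vert f t = vert g t := by
    intro t ht
    rw [← init_edge, ← init_edge, hedge t ht]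
  funext v
  have hex : ∃ t, t < 2 ^ (m + 2) ∧ vert f t = v := by
    obtain ⟨t, ht, hte⟩ := (eulerian hf).1.surjOn
      (Set.mem_univ (Fin.snoc (α := fun _ => Bool) v true))
    exact ⟨t, ht, by rw [← init_edge, hte, Fin.init_snoc]⟩
  classical
  obtain ⟨ht, hv⟩ := Nat.find_spec hex
  set t := Nat.find hex with htdef
  have hmin : ∀ t' < t, vert f t' ≠ v := fun t' ht' hv' =>
    Nat.find_min hex ht' ⟨by omega, hv'⟩
  have hbf : bit f t = !f v := by
    rw [bit_of_first (by rw [hv]; exact hmin), hv]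
  have hbg : bit g t = !g v := by
    rw [bit_of_first, ← hvert t ht, hv]
    intro t' ht'
    rw [← hvert t ht, ← hvert t' (by omega), hv]
    exact hmin t' ht'
  have : bit f t = bit g t := by rw [← edge_last, ← edge_last, hedge t ht]
  rw [hbf, hbg] at this
  simpa using this

/-- The last-exit rule that appends `0`, except that it follows `g` at vertices ending in `01`. -/
def rule (g : (Fin m → Bool) → Bool) (v : Fin (m + 2) → Bool) : Bool :=
  v (Fin.last _) && !v (Fin.last m).castSucc && g fun i => v i.castSucc.castSucc

theorem shift_last (v : Fin (m + 1) → Bool) (b : Bool) : shift v b (Fin.last _) = b := by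
  simp only [shift, Fin.tail, Fin.succ_last, Fin.snoc_last]

theorem shift_castSucc (v : Fin (m + 1) → Bool) (b : Bool) (i : Fin m) :
    shift v b i.castSucc = v i.succ := by
  simp only [shift, Fin.tail, Fin.succ_castSucc, Fin.snoc_castSucc]

/-- After at most two steps the rule appends `0`, and it goes on doing so. -/
theorem exists_iterate_rule (g : (Fin m → Bool) → Bool) (v : Fin (m + 2) → Bool) :
    ∃ j, (fun v => shift v (rule g v))^[j] v = fun _ => false := by
  set F : (Fin (m + 2) → Bool) → Fin (m + 2) → Bool := fun v => shift v (rule g v) with hF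
  have hlast : ∀ v, F v (Fin.last _) = rule g v := fun v => shift_last _ _
  have hcast : ∀ v (i : Fin (m + 1)), F v i.castSucc = v i.succ := fun v i => shift_castSucc _ _ _
  have hzero : ∀ v : Fin (m + 2) → Bool, v (Fin.last _) = false →
      ∀ j (i : Fin (m + 2)), m + 1 ≤ i + j → F^[j] v i = false := by
    intro v hv j
    induction j with
    | zero =>
      intro i hi
      have : i = Fin.last _ := Fin.ext (by simp; omega)
      rw [this]
      exact hv
    | succ j ih =>
      intro i hi
      rw [Function.iterate_succ_apply']
      induction i using Fin.lastCases with
      | last =>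
        have := ih (Fin.last _) (by simp)
        rw [hlast]
        simp [rule, this]
      | cast i =>
        rw [hcast]
        apply ih
        simp at hi ⊢
        omega
  have hdone : ∀ v : Fin (m + 2) → Bool, v (Fin.last _) = false →
      F^[m + 1] v = fun _ => false := fun v hv => funext fun i => hzero v hv _ i (by omega)
  by_cases h0 : v (Fin.last _) = false
  · exact ⟨_, hdone v h0⟩
  by_cases h1 : F v (Fin.last _) = false
  · exact ⟨m + 1 + 1, hdone _ h1⟩
  · refine ⟨m + 1 + 2, hdone (F (F v)) ?_⟩
    have h2 : F v (Fin.last m).castSucc = true := by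
      rw [hcast, Fin.succ_last]
      simpa using h0
    rw [hlast]
    simp [rule, h2]

theorem rule_injective : Function.Injective (rule : ((Fin m → Bool) → Bool) → _) := by
  intro g g' h
  funext u
  have := congrFun h (Fin.snoc (α := fun _ => Bool) (Fin.snoc (α := fun _ => Bool) u false) true)
  simpa [rule] using this

/-- There are at least `2 ^ (2 ^ k / 8)` binary De Bruijn cycles of order `k`. -/
theorem exists_finset (k : ℕ) (hk : 3 ≤ k) :
    ∃ A : Finset (List Bool), (∀ d ∈ A, IsDeBruijnCycle k d ∧ d.length = 2 ^ k) ∧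
      2 ^ (2 ^ k / 8) ≤ A.card := by
  obtain ⟨m, rfl⟩ : ∃ m, k = m + 3 := ⟨k - 3, by omega⟩
  classical
  refine ⟨Finset.univ.image fun g : (Fin m → Bool) → Bool => cycle (rule g), ?_, ?_⟩
  · intro d hd
    obtain ⟨g, -, rfl⟩ := Finset.mem_image.1 hd
    exact ⟨isDeBruijnCycle_cycle (exists_iterate_rule g), length_cycle⟩
  · rw [Finset.card_image_of_injective]
    · have : 2 ^ (m + 3) / 8 = 2 ^ m := by
        rw [pow_add]; norm_num
      simp [this]
    · intro g g' h
      exact rule_injective (cycle_injOn (exists_iterate_rule g) (exists_iterate_rule g') h)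

end DeBruijn

/-! ### The entropy of periodic words -/

section

variable {α : Type*} [DecidableEq α]

theorem empEntropyZero_nonneg [Fintype α] (s : List α) : 0 ≤ empEntropyZero s := by
  refine mul_nonneg (by positivity) (Finset.sum_nonneg fun a _ => ?_)
  rcases Nat.eq_zero_or_pos (s.count a) with h | h
  · simp [h]
  · refine mul_nonneg (by positivity) (Real.logb_nonneg (by norm_num) ?_)
    rw [one_le_div (by exact_mod_cast h)]
    exact_mod_cast List.count_le_length

theorem modEntropyZero_nonneg [Fintype α] (s : List α) : 0 ≤ modEntropyZero s := by
  unfold modEntropyZero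
  split_ifs
  · exact le_rfl
  · positivity
  · exact empEntropyZero_nonneg s

theorem empEntropyZero_eq_zero [Fintype α] {s : List α} (h : ∀ a ∈ s, ∀ b ∈ s, a = b) :
    empEntropyZero s = 0 := by
  unfold empEntropyZero
  rw [Finset.sum_eq_zero, mul_zero]
  intro a _
  by_cases ha : a ∈ s
  · have hc : s.count a = s.length := List.count_eq_length.2 fun b hb => h a ha b hb
    have hne : (s.length : ℝ) ≠ 0 := by
      simpa using List.ne_nil_of_mem ha
    rw [hc, div_self hne]
    simp
  · simp [List.count_eq_zero_of_not_mem ha]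

/-- A string of one repeated letter is charged the length of its length in binary. -/
theorem length_mul_modEntropyZero_le [Fintype α] {s : List α} (h : ∀ a ∈ s, ∀ b ∈ s, a = b)
    {n : ℕ} (hn : s.length ≤ n) (hn1 : 1 ≤ n) :
    (s.length : ℝ) * modEntropyZero s ≤ Real.logb 2 n + 1 := by
  have hlog : 0 ≤ Real.logb 2 n := Real.logb_nonneg (by norm_num) (by exact_mod_cast hn1)
  unfold modEntropyZero
  split_ifs with h1 h2
  · linarith
  · have hpos : 0 < s.length := List.length_pos_iff.2 h1
    rw [← mul_assoc, mul_one_div_cancel (by positivity), one_mul]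
    have h3 : (Nat.log 2 s.length : ℝ) ≤ Real.logb 2 s.length := Real.natLog_le_logb _ _
    have h4 : Real.logb 2 s.length ≤ Real.logb 2 n :=
      Real.logb_le_logb_of_le (by norm_num) (by exact_mod_cast hpos) (by exact_mod_cast hn)
    linarith
  · exact absurd (empEntropyZero_eq_zero h) h2

theorem modEntropy_set_nonneg [Fintype α] (k : ℕ) (s : List α) :
    ∀ h ∈ {h : ℝ | ∃ S : Finset (List α), IsSuffixCover k S ∧
      h = (1 / (s.length : ℝ)) *
        ∑ w ∈ S, ((followers w s).length : ℝ) * modEntropyZero (followers w s)}, 0 ≤ h := by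
  rintro h ⟨S, -, rfl⟩
  exact mul_nonneg (by positivity) (Finset.sum_nonneg fun w _ =>
    mul_nonneg (by positivity) (modEntropyZero_nonneg _))

theorem modEntropy_nonneg [Fintype α] (k : ℕ) (s : List α) : 0 ≤ modEntropy k s :=
  Real.sInf_nonneg (modEntropy_set_nonneg k s)

theorem isSuffixCover_image_ofFn [Fintype α] (k : ℕ) :
    IsSuffixCover k ((Finset.univ : Finset (Fin k → α)).image List.ofFn) := by
  constructor
  · intro w hw
    obtain ⟨u, -, rfl⟩ := Finset.mem_image.1 hw
    simp
  · intro v hv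
    subst hv
    refine ⟨v, ⟨?_, List.suffix_refl v⟩, ?_⟩
    · exact Finset.mem_image.2 ⟨v.get, Finset.mem_univ _, List.ofFn_get v⟩
    · rintro w ⟨hw, hwv⟩
      obtain ⟨u, -, rfl⟩ := Finset.mem_image.1 hw
      exact hwv.eq_of_length (by simp)

theorem modEntropy_le [Fintype α] (k : ℕ) (s : List α) :
    (s.length : ℝ) * modEntropy k s ≤
      ∑ w ∈ (Finset.univ : Finset (Fin k → α)).image List.ofFn,
        ((followers w s).length : ℝ) * modEntropyZero (followers w s) := by
  have h := csInf_le ⟨0, modEntropy_set_nonneg k s⟩ ⟨_, isSuffixCover_image_ofFn k, rfl⟩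
  have hnn : 0 ≤ ∑ w ∈ (Finset.univ : Finset (Fin k → α)).image List.ofFn,
      ((followers w s).length : ℝ) * modEntropyZero (followers w s) :=
    Finset.sum_nonneg fun w _ => mul_nonneg (by positivity) (modEntropyZero_nonneg _)
  refine (mul_le_mul_of_nonneg_left h (Nat.cast_nonneg _)).trans ?_
  rcases Nat.eq_zero_or_pos s.length with h0 | h0
  · simpa [h0] using hnn
  · rw [← mul_assoc, mul_one_div_cancel (by positivity), one_mul]

theorem length_followers_le (w s : List α) : (followers w s).length ≤ s.length :=
  (List.length_filterMap_le _ _).trans (by simp)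

theorem mem_followers {w s : List α} {x : α} (h : x ∈ followers w s) :
    ∃ i, (s.drop i).take w.length = w ∧ s[i + w.length]? = some x := by
  obtain ⟨i, -, hi⟩ := List.mem_filterMap.1 h
  split_ifs at hi with hw
  exact ⟨i, hw, hi⟩

end

theorem take_drop_periodicWord {α : Type*} (φ : Bool → α) {n k i : ℕ} {d : List Bool}
    (hk : k ≤ d.length) (hi : i + k ≤ n) :
    ((periodicWord φ n d).drop i).take k = ((d.rotate (i % d.length)).take k).map φ := by
  refine List.ext_getElem (by simp; omega) fun j h1 h2 => ?_
  have hj : j < k := by simp at h2; omega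
  rw [List.getElem_take, List.getElem_drop, List.getElem_map, List.getElem_take,
    List.getElem_rotate]
  simp only [periodicWord, List.getElem_map, List.getElem_range]
  have hlt : (i + j) % d.length < d.length := Nat.mod_lt _ (by omega)
  rw [List.getD_eq_getElem _ _ hlt]
  congr 2
  rw [Nat.add_mod_mod, add_comm]

theorem isPrefixOfPowers_periodicWord {α : Type*} (φ : Bool → α) (n : ℕ) {d : List Bool}
    (hd : d ≠ []) : IsPrefixOfPowers (d.map φ) (periodicWord φ n d) := by
  have hpos : 0 < d.length := List.length_pos_iff.2 hd
  have key : ∀ r, periodicWord φ (r * d.length) d = (List.replicate r (d.map φ)).flatten := by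
    intro r
    induction r with
    | zero => simp [periodicWord]
    | succ r ih =>
      rw [List.replicate_succ', List.flatten_append, ← ih, List.flatten_singleton, periodicWord,
        Nat.succ_mul, List.range_add, List.map_append, List.map_map]
      congr 1
      refine List.ext_getElem (by simp) fun j h1 h2 => ?_
      have hj : j < d.length := by simpa using h2
      simp [Nat.mod_eq_of_lt hj, List.getElem?_eq_getElem hj]
  refine ⟨n, ?_⟩
  rw [← key]
  refine List.IsPrefix.map _ ?_
  obtain ⟨r, hr⟩ : ∃ r, n * d.length = n + r :=
    ⟨n * d.length - n, by have := Nat.le_mul_of_pos_right n hpos; omega⟩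
  rw [hr, List.range_add]
  exact List.prefix_append _ _

/-- Every word of length `k` that occurs in a periodic word over a De Bruijn cycle of order `k` is
always followed by the same letter, so the entropy comes from one logarithmic charge for each
of the `2 ^ k` words. -/
theorem length_mul_modEntropy_periodicWord_le {α : Type*} [Fintype α] [DecidableEq α]
    {φ : Bool → α} (hφ : Function.Injective φ) {n k : ℕ} (hn : 2 ≤ n) {d : List Bool}
    (hd : IsDeBruijnCycle k d) (hlen : d.length = 2 ^ k) :
    (n : ℝ) * modEntropy k (periodicWord φ n d) ≤ 2 * (2 : ℝ) ^ k * Real.logb 2 n := by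
  classical
  set s := periodicWord φ n d with hs
  have hsl : s.length = n := by simp [hs]
  have hkd : k ≤ d.length := hlen ▸ Nat.lt_two_pow_self.le
  have hlog : 1 ≤ Real.logb 2 n := by
    rw [Real.le_logb_iff_rpow_le (by norm_num) (by positivity)]
    simpa using (by exact_mod_cast hn : (2 : ℝ) ≤ n)
  have hfol : ∀ w : List α, w.length = k → ∀ x ∈ followers w s, ∃ i,
      ((d.rotate (i % d.length)).take k).map φ = w ∧ x = φ (d.getD ((i + k) % d.length) false) := by
    rintro w hw x hx
    obtain ⟨i, h1, h2⟩ := mem_followers hx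
    rw [hw] at h1 h2
    rw [hs, getElem?_periodicWord] at h2
    split_ifs at h2 with hik
    rw [hs, take_drop_periodicWord φ hkd (by omega)] at h1
    exact ⟨i, h1, (Option.some.inj h2).symm⟩
  have hconst : ∀ w : List α, w.length = k → ∀ x ∈ followers w s, ∀ y ∈ followers w s, x = y := by
    intro w hw x hx y hy
    obtain ⟨i, hi, rfl⟩ := hfol w hw x hx
    obtain ⟨j, hj, rfl⟩ := hfol w hw y hy
    have hij := List.map_injective_iff.2 hφ (hi.trans hj.symm)
    have hpos : 0 < d.length := by rw [hlen]; positivity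
    have hmod : i % d.length = j % d.length :=
      (hd ((d.rotate (i % d.length)).take k) (by simp [hkd])).unique
        ⟨Nat.mod_lt _ hpos, rfl⟩ ⟨Nat.mod_lt _ hpos, hij.symm⟩
    rw [Nat.add_mod, hmod, ← Nat.add_mod]
  set S := (Finset.univ : Finset (Fin k → α)).image List.ofFn with hS
  set S' : Finset (List α) :=
    (Finset.univ : Finset (Fin k → Bool)).image fun u => List.ofFn fun i => φ (u i) with hS'
  have hSlen : ∀ w ∈ S, w.length = k := by
    intro w hw
    obtain ⟨u, -, rfl⟩ := Finset.mem_image.1 hw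
    simp
  have hsub : S' ⊆ S := by
    intro w hw
    obtain ⟨u, -, rfl⟩ := Finset.mem_image.1 hw
    exact Finset.mem_image.2 ⟨_, Finset.mem_univ _, rfl⟩
  have hle := modEntropy_le k s
  rw [hsl] at hle
  calc (n : ℝ) * modEntropy k s
      ≤ ∑ w ∈ S, ((followers w s).length : ℝ) * modEntropyZero (followers w s) := hle
    _ = ∑ w ∈ S', ((followers w s).length : ℝ) * modEntropyZero (followers w s) := by
        refine (Finset.sum_subset hsub fun w hw hw' => ?_).symm
        have : followers w s = [] := by
          rw [List.eq_nil_iff_forall_not_mem]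
          intro x hx
          obtain ⟨i, hi, -⟩ := hfol w (hSlen w hw) x hx
          apply hw'
          set u := (d.rotate (i % d.length)).take k with hu
          have hul : u.length = k := by simp [hu, hkd]
          refine Finset.mem_image.2 ⟨fun j => u[j], Finset.mem_univ _, ?_⟩
          rw [← hi]
          refine List.ext_getElem (by simp [hul]) fun j h1 h2 => ?_
          simp
        simp [this]
    _ ≤ ∑ w ∈ S', (Real.logb 2 n + 1) := by
        refine Finset.sum_le_sum fun w hw => ?_
        exact length_mul_modEntropyZero_le (hconst w (hSlen w (hsub hw)))
          (hsl ▸ length_followers_le w s) (by omega)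
    _ = (S'.card : ℝ) * (Real.logb 2 n + 1) := by rw [Finset.sum_const, nsmul_eq_mul]
    _ ≤ (2 : ℝ) ^ k * (Real.logb 2 n + 1) := by
        refine mul_le_mul_of_nonneg_right ?_ (by linarith)
        have : S'.card ≤ 2 ^ k := Finset.card_image_le.trans (by simp)
        exact_mod_cast this
    _ ≤ 2 * (2 : ℝ) ^ k * Real.logb 2 n := by
        have : (0 : ℝ) < 2 ^ k := by positivity
        nlinarith

/-! ### Hard instances for one-stream compressors -/

/-- The counting step: unless `k` is small compared with the memory and the number of passes, some
periodic word over an incompressible De Bruijn cycle has a code word of linear length. -/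
theorem exists_incompressible_cycle {α : Type*} {C : List α → List Bool} {m p : ℕ → ℕ}
    (hC : OneStreamComputable C m p) (hinj : Function.Injective C) {φ : Bool → α}
    (hφ : Function.Injective φ) {n k : ℕ} (hk : 7 ≤ k) (hkn : 2 ^ k ≤ n)
    (hmp : 64 * (p n * (m n + 2)) ≤ 2 ^ k) (D : List Bool → List Bool) :
    ∃ d, IsDeBruijnCycle k d ∧ d.length = 2 ^ k ∧ (∀ x, D x = d → 2 ^ k ≤ 32 * x.length) ∧
      n ≤ 128 * (C (periodicWord φ n d)).length := by
  classical
  obtain ⟨q, hq⟩ : ∃ q, 2 ^ k = 128 * q := by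
    obtain ⟨j, rfl⟩ := Nat.exists_eq_add_of_le hk
    exact ⟨2 ^ j, by rw [pow_add]; norm_num⟩
  have hq0 : 0 < q := by
    have : 0 < 2 ^ k := by positivity
    omega
  obtain ⟨A, hA, hAcard⟩ := DeBruijn.exists_finset k (by omega)
  obtain ⟨bits, hsum, hbits⟩ := hC.exists_bits hinj hφ n (K := 2 ^ k) (by positivity)
  set B := n / 2 ^ k with hB
  have hB1 : 1 ≤ B := (Nat.one_le_div_iff (by positivity)).2 hkn
  have hA16 : 2 ^ (16 * q) ≤ A.card := by
    have : 2 ^ k / 8 = 16 * q := by omega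
    rwa [this] at hAcard
  have hquarter : ∀ {N e : ℕ}, N < 2 ^ e → e + 2 ≤ 16 * q → 4 * N ≤ A.card := by
    intro N e h1 h2
    have h3 : 2 ^ (e + 2) ≤ 2 ^ (16 * q) := Nat.pow_le_pow_right (by norm_num) h2
    rw [pow_add] at h3
    omega
  -- few cycles are compressible
  set E := A.filter fun d => ∃ x, D x = d ∧ x.length ≤ 4 * q with hE
  have hEcard : 4 * E.card ≤ A.card := by
    have hex : ∀ d, ∃ x, d ∈ E → D x = d ∧ x.length ≤ 4 * q := by
      intro d
      by_cases hd : d ∈ E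
      · obtain ⟨x, hx⟩ := (Finset.mem_filter.1 hd).2
        exact ⟨x, fun _ => hx⟩
      · exact ⟨[], fun h => absurd h hd⟩
    choose x hx using hex
    have hxi : Set.InjOn x E := by
      intro d hd d' hd' h
      rw [← (hx d hd).1, ← (hx d' hd').1, h]
    refine hquarter (e := 4 * q + 1) ?_ (by omega)
    rw [← Finset.card_image_of_injOn hxi]
    refine card_lt_of_length_le fun l hl => ?_
    obtain ⟨d, hd, rfl⟩ := Finset.mem_image.1 hl
    exact (hx d hd).2
  -- for every block, few cycles cause little output there
  set r : List Bool → ℕ → Prop := fun d i => bits i d ≤ 4 * q with hr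
  have hbad : ∀ i ∈ Finset.range B, 4 * (A.filter fun d => r d i).card ≤ A.card := by
    intro i hi
    refine hquarter (hbits _ (4 * q) i (fun d hd => (hA d (Finset.mem_filter.1 hd).1).2)
      (Finset.mem_range.1 hi) fun d hd => (Finset.mem_filter.1 hd).2) ?_
    have : 2 * p n * (m n + 2) = 2 * (p n * (m n + 2)) := by ring
    omega
  obtain ⟨d, hdA, hdE, hdr⟩ : ∃ d ∈ A, d ∉ E ∧
      2 * ((Finset.range B).filter fun i => r d i).card ≤ B := by
    by_contra hno
    push Not at hno
    have h1 : (A \ E).card * B ≤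
        2 * ∑ d ∈ A \ E, ((Finset.range B).filter fun i => r d i).card := by
      rw [Finset.mul_sum, ← smul_eq_mul]
      refine Finset.card_nsmul_le_sum _ _ _ fun d hd => ?_
      rw [Finset.mem_sdiff] at hd
      exact (hno d hd.1 hd.2).le
    have h2 : ∑ d ∈ A \ E, ((Finset.range B).filter fun i => r d i).card ≤
        ∑ d ∈ A, ((Finset.range B).filter fun i => r d i).card :=
      Finset.sum_le_sum_of_subset Finset.sdiff_subset
    have h3 : ∑ d ∈ A, ((Finset.range B).filter fun i => r d i).card =
        ∑ i ∈ Finset.range B, (A.filter fun d => r d i).card :=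
      Finset.sum_card_bipartiteAbove_eq_sum_card_bipartiteBelow r
    have h4 : 4 * ∑ i ∈ Finset.range B, (A.filter fun d => r d i).card ≤ B * A.card := by
      rw [Finset.mul_sum]
      refine (Finset.sum_le_card_nsmul _ _ _ hbad).trans ?_
      simp
    have h5 : (A \ E).card = A.card - E.card :=
      Finset.card_sdiff_of_subset (Finset.filter_subset _ _)
    have h6 : 0 < A.card := lt_of_lt_of_le (by positivity) hA16
    have h7 : 3 * A.card ≤ 4 * (A \ E).card := by omega
    nlinarith
  obtain ⟨hdB, hdl⟩ := hA d hdA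
  refine ⟨d, hdB, hdl, ?_, ?_⟩
  · intro x hx
    by_contra hlt
    exact hdE (Finset.mem_filter.2 ⟨hdA, x, hx, by omega⟩)
  · -- at least half of the blocks cause at least `4 * q` bits each
    have h1 : ((Finset.range B).filter fun i => ¬ r d i).card * (4 * q) ≤
        (C (periodicWord φ n d)).length := by
      refine le_trans ?_ (hsum d)
      rw [← smul_eq_mul]
      refine (Finset.card_nsmul_le_sum _ (fun i => bits i d) _ fun i hi => ?_).trans
        (Finset.sum_le_sum_of_subset (Finset.filter_subset _ _))
      exact (not_le.1 (Finset.mem_filter.1 hi).2).le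
    have h2 := Finset.card_filter_add_card_filter_not (s := Finset.range B) (fun i => r d i)
    rw [Finset.card_range] at h2
    have h3 : B ≤ 2 * ((Finset.range B).filter fun i => ¬ r d i).card := by omega
    have h4 : n < 2 ^ k * (B + 1) := Nat.lt_mul_div_succ n (by positivity)
    rw [hq] at h4
    nlinarith

theorem tendsto_logb_natCast_atTop :
    Tendsto (fun n : ℕ => Real.logb 2 (n : ℝ)) atTop atTop :=
  (Real.tendsto_logb_atTop (by norm_num)).comp tendsto_natCast_atTop_atTop

theorem eventually_mul_logb_pow_le (a : ℝ) (c : ℕ) {ε : ℝ} (hε : 0 < ε) :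
    ∀ᶠ n : ℕ in atTop, a * Real.logb 2 n ^ c ≤ ε * n := by
  have h1 : (fun x : ℝ => a * Real.logb 2 x ^ c) =o[atTop] fun x : ℝ => x := by
    have h2 : (fun x : ℝ => a * Real.logb 2 x ^ c) =
        fun x : ℝ => (a / Real.log 2 ^ c) * Real.log x ^ c := by
      funext x
      rw [Real.logb, div_pow]
      ring
    rw [h2]
    exact (Real.isLittleO_pow_log_id_atTop (n := c)).const_mul_left _
  have h3 := (h1.comp_tendsto tendsto_natCast_atTop_atTop).bound hε
  filter_upwards [h3] with n hn
  simp only [Function.comp_apply, Real.norm_eq_abs, Nat.abs_cast] at hn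
  exact (le_abs_self _).trans hn

theorem PolyLog.exists_entropy_bound {k : ℕ → ℕ} (hk : PolyLog fun n => 2 ^ k n) :
    ∃ c : ℕ, ∀ᶠ n : ℕ in atTop,
      2 * (2 : ℝ) ^ k n * Real.logb 2 n ≤ Real.logb 2 n ^ c := by
  obtain ⟨c, hc⟩ := hk
  refine ⟨c + 2, ?_⟩
  filter_upwards [hc, tendsto_logb_natCast_atTop.eventually_ge_atTop 2] with n h1 h2
  push_cast at h1
  have h3 : 0 ≤ Real.logb 2 (n : ℝ) ^ c := by positivity
  calc 2 * (2 : ℝ) ^ k n * Real.logb 2 n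
      ≤ 2 * Real.logb 2 n ^ c * Real.logb 2 n := by gcongr
    _ ≤ Real.logb 2 n * Real.logb 2 n ^ c * Real.logb 2 n := by gcongr
    _ = Real.logb 2 n ^ (c + 2) := by ring

theorem OneStreamComputable.one_le_passes {α : Type*} [Nonempty α] {C : List α → List Bool}
    {m p : ℕ → ℕ} (hC : OneStreamComputable C m p) (n : ℕ) : 1 ≤ p n := by
  obtain ⟨M, -, h⟩ := hC n
  obtain ⟨c, -, -, hc⟩ := h (List.replicate n (Classical.arbitrary α)) (by simp)
  omega

theorem OneStreamComputable.eventually_exists_hard_word {α : Type*} [Fintype α] [DecidableEq α]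
    {C : List α → List Bool} {m p : ℕ → ℕ} (hC : OneStreamComputable C m p)
    (hinj : Function.Injective C) {k : ℕ → ℕ}
    (hk : Tendsto (fun n : ℕ => (2 : ℝ) ^ k n / (((m n : ℝ) + 1) * (p n : ℝ))) atTop atTop)
    (hpk : PolyLog fun n => 2 ^ k n) {φ : Bool → α} (hφ : Function.Injective φ) :
    ∃ c : ℕ, ∀ᶠ n : ℕ in atTop, ∀ D : List Bool → List Bool,
      ∃ (d : List Bool) (s : List α),
        IsDeBruijnCycle (k n) d ∧
        (∀ x : List Bool, D x = d → 1 / 128 * (d.length : ℝ) ≤ (x.length : ℝ)) ∧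
        s.length = n ∧
        IsPrefixOfPowers (d.map φ) s ∧
        (n : ℝ) * modEntropy (k n) s ≤ 2 * (2 : ℝ) ^ k n * Real.logb 2 n ∧
        (n : ℝ) * modEntropy (k n) s ≤ (Real.logb 2 n) ^ c ∧
        1 / 128 * (n : ℝ) ≤ ((C s).length : ℝ) := by
  obtain ⟨c, hc⟩ := hpk.exists_entropy_bound
  obtain ⟨c', hc'⟩ := hpk
  have : Nonempty α := ⟨φ true⟩
  refine ⟨c, ?_⟩
  filter_upwards [hc, hc', eventually_mul_logb_pow_le 1 c' one_pos, eventually_ge_atTop 2,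
    hk.eventually_ge_atTop 128] with n h1 h2 h3 hn h4 D
  have hp := hC.one_le_passes n
  have hkn : 2 ^ k n ≤ n := by
    have : ((2 ^ k n : ℕ) : ℝ) ≤ n := by linarith
    exact_mod_cast this
  have h5 : 128 * ((m n + 1) * p n) ≤ 2 ^ k n := by
    rw [le_div_iff₀ (by positivity)] at h4
    exact_mod_cast h4
  have hmp : 64 * (p n * (m n + 2)) ≤ 2 ^ k n := by nlinarith
  have hk7 : 7 ≤ k n := by
    by_contra hlt
    have h6 : 2 ^ k n ≤ 2 ^ 6 := Nat.pow_le_pow_right (by norm_num) (by omega)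
    have h7 : 1 * 1 ≤ (m n + 1) * p n := Nat.mul_le_mul (by omega) hp
    omega
  obtain ⟨d, hd, hdl, hdx, hlen⟩ := exists_incompressible_cycle hC hinj hφ hk7 hkn hmp D
  have hent := length_mul_modEntropy_periodicWord_le hφ hn hd hdl
  refine ⟨d, periodicWord φ n d, hd, fun x hx => ?_, by simp, ?_, hent, hent.trans h1, ?_⟩
  · have h6 : ((2 ^ k n : ℕ) : ℝ) ≤ 32 * x.length := by exact_mod_cast hdx x hx
    rw [hdl]
    have : (0 : ℝ) ≤ x.length := by positivity
    linarith
  · refine isPrefixOfPowers_periodicWord φ n fun h => ?_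
    rw [h] at hdl
    exact (pow_pos two_pos (k n)).ne hdl
  · have : (n : ℝ) ≤ 128 * (C (periodicWord φ n d)).length := by exact_mod_cast hlen
    linarith

/-- The order `c (⌊log log n⌋ + 1)`, for which `2 ^ k` lies between two powers of `log n`. -/
def loglogOrder (c n : ℕ) : ℕ := c * (Nat.log 2 (Nat.log 2 n) + 1)

theorem logb_le_two_pow_loglog (n : ℕ) :
    Real.logb 2 n ≤ (2 : ℝ) ^ (Nat.log 2 (Nat.log 2 n) + 1) := by
  have h1 : Real.logb 2 n ≤ (Nat.log 2 n : ℝ) + 1 := by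
    rcases Nat.eq_zero_or_pos n with rfl | hn
    · simp
    · have h2 : (n : ℝ) ≤ (2 : ℝ) ^ (Nat.log 2 n + 1) := by
        exact_mod_cast (Nat.lt_pow_succ_log_self (by norm_num) n).le
      rw [Real.logb_le_iff_le_rpow (by norm_num) (by exact_mod_cast hn)]
      exact_mod_cast h2
  have h3 : Nat.log 2 n + 1 ≤ 2 ^ (Nat.log 2 (Nat.log 2 n) + 1) :=
    Nat.lt_pow_succ_log_self (by norm_num) _
  have h4 : (Nat.log 2 n : ℝ) + 1 ≤ (2 : ℝ) ^ (Nat.log 2 (Nat.log 2 n) + 1) := by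
    exact_mod_cast h3
  exact h1.trans h4

theorem two_pow_loglog_le {n : ℕ} (hn : 2 ≤ n) :
    (2 : ℝ) ^ (Nat.log 2 (Nat.log 2 n) + 1) ≤ 2 * Real.logb 2 n := by
  have h1 : Nat.log 2 n ≠ 0 := (Nat.log_pos (by norm_num) hn).ne'
  have h2 : (2 : ℝ) ^ Nat.log 2 (Nat.log 2 n) ≤ (Nat.log 2 n : ℝ) := by
    exact_mod_cast Nat.pow_log_le_self 2 h1
  have h3 : (Nat.log 2 n : ℝ) ≤ Real.logb 2 n := Real.natLog_le_logb _ _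
  rw [pow_succ]
  linarith

theorem polyLog_two_pow_loglogOrder (c : ℕ) : PolyLog fun n => 2 ^ loglogOrder c n := by
  refine ⟨2 * c, ?_⟩
  filter_upwards [eventually_ge_atTop 2, tendsto_logb_natCast_atTop.eventually_ge_atTop 2]
    with n hn hL
  push_cast
  rw [loglogOrder, mul_comm c, pow_mul, pow_mul]
  gcongr
  refine (two_pow_loglog_le hn).trans ?_
  nlinarith

theorem tendsto_loglogOrder {c : ℕ} (hc : 1 ≤ c) : Tendsto (loglogOrder c) atTop atTop := by
  have h1 : Tendsto (fun n : ℕ => Nat.log 2 n) atTop atTop :=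
    tendsto_atTop_atTop.2 fun b => ⟨2 ^ b, fun n hn => Nat.le_log_of_pow_le (by norm_num) hn⟩
  refine tendsto_atTop_mono (fun n => ?_) (h1.comp h1)
  simp only [Function.comp_apply, loglogOrder]
  nlinarith

/-- Numbers that grow more slowly than doubly exponentially in the order are sublinear at
`k = c (⌊log log n⌋ + 1)`. -/
theorem eventually_loglogOrder_le {g : ℕ → ℝ}
    (hg : ∀ ε : ℝ, 0 < ε → ∀ᶠ k : ℕ in atTop, g k ≤ (2 : ℝ) ^ ((2 : ℝ) ^ (ε * (k : ℝ))))
    {c : ℕ} (hc : 1 ≤ c) : ∀ᶠ n : ℕ in atTop, g (loglogOrder c n) ≤ 1 / 512 * n := by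
  have hc0 : (0 : ℝ) < c := by exact_mod_cast hc
  have h1 := (tendsto_loglogOrder hc).eventually (hg (1 / (2 * c)) (by positivity))
  filter_upwards [h1, eventually_ge_atTop 2, tendsto_logb_natCast_atTop.eventually_ge_atTop 18]
    with n h1 hn hL
  refine h1.trans ?_
  set L := Real.logb 2 (n : ℝ) with hLdef
  set t := Nat.log 2 (Nat.log 2 n) with ht
  have hn0 : (0 : ℝ) < n := by positivity
  have he : 1 / (2 * (c : ℝ)) * (loglogOrder c n : ℝ) = ((t : ℝ) + 1) / 2 := by
    rw [loglogOrder]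
    push_cast
    rw [ht]
    field_simp
  -- the inner exponent is at most the square root of `2 L`, hence at most `L / 2`
  have hsq : ((2 : ℝ) ^ (((t : ℝ) + 1) / 2)) ^ 2 = 2 ^ (t + 1) := by
    rw [← Real.rpow_natCast, ← Real.rpow_mul (by norm_num), ← Real.rpow_natCast]
    congr 1
    push_cast
    ring
  have hin : (2 : ℝ) ^ (((t : ℝ) + 1) / 2) ≤ L / 2 := by
    refine le_of_sq_le_sq ?_ (by linarith)
    rw [hsq]
    refine (two_pow_loglog_le hn).trans ?_
    nlinarith
  rw [he]
  set x := (2 : ℝ) ^ (L / 2) with hx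
  have hxn : x ^ 2 = n := by
    rw [hx, ← Real.rpow_natCast, ← Real.rpow_mul (by norm_num)]
    have : L / 2 * ((2 : ℕ) : ℝ) = L := by push_cast; ring
    rw [this, hLdef, Real.rpow_logb (by norm_num) (by norm_num) hn0]
  have hx9 : 512 ≤ x := by
    have : (2 : ℝ) ^ (9 : ℝ) ≤ x := Real.rpow_le_rpow_of_exponent_le (by norm_num) (by linarith)
    have h9 : (2 : ℝ) ^ (9 : ℝ) = 512 := by norm_num
    linarith
  have h2 : (2 : ℝ) ^ ((2 : ℝ) ^ (((t : ℝ) + 1) / 2)) ≤ x :=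
    Real.rpow_le_rpow_of_exponent_le (by norm_num) hin
  nlinarith

/-- Along `k = c (⌊log log n⌋ + 1)` an entropy-only bound would be sublinear on the hard words. -/
theorem not_achievesEntropyOnlyBound {α : Type*} [Fintype α] [DecidableEq α] [Nontrivial α]
    {C : List α → List Bool} {m p : ℕ → ℕ} (hinj : Function.Injective C)
    (hC : OneStreamComputable C m p) (hm : PolyLog m) (hp : PolyLog p) :
    ¬ AchievesEntropyOnlyBound C := by
  rintro ⟨lam, g, hg, hbound⟩
  obtain ⟨a, ha⟩ := hm
  obtain ⟨b, hb⟩ := hp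
  set c := a + b + 1 with hcdef
  obtain ⟨x, y, hxy⟩ := exists_pair_ne α
  have hφ : Function.Injective fun t : Bool => if t then x else y := by
    intro s t h
    cases s <;> cases t <;> simp_all [hxy.symm]
  have hk : Tendsto (fun n : ℕ => (2 : ℝ) ^ loglogOrder c n / (((m n : ℝ) + 1) * (p n : ℝ)))
      atTop atTop := by
    refine tendsto_atTop_mono' _ ?_ (tendsto_logb_natCast_atTop.atTop_div_const (two_pos))
    filter_upwards [ha, hb, tendsto_logb_natCast_atTop.eventually_ge_atTop 1] with n h1 h2 hL
    have hp1 : (1 : ℝ) ≤ p n := by exact_mod_cast hC.one_le_passes n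
    rw [le_div_iff₀ (by positivity)]
    set L := Real.logb 2 (n : ℝ)
    have h3 : L ^ c ≤ (2 : ℝ) ^ loglogOrder c n := by
      rw [loglogOrder, mul_comm c, pow_mul]
      exact pow_le_pow_left₀ (by linarith) (logb_le_two_pow_loglog n) _
    have h4 : (1 : ℝ) ≤ L ^ a := one_le_pow₀ hL
    calc L / 2 * (((m n : ℝ) + 1) * p n) ≤ L / 2 * ((L ^ a + L ^ a) * L ^ b) := by gcongr
      _ = L ^ c := by rw [hcdef]; ring
      _ ≤ _ := h3
  obtain ⟨e, he⟩ := hC.eventually_exists_hard_word hinj hk (polyLog_two_pow_loglogOrder c) hφ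
  obtain ⟨n, h1, h2, h3, hn⟩ := (he.and ((eventually_loglogOrder_le hg (c := c) (by omega)).and
    ((eventually_mul_logb_pow_le |lam| e (ε := 1 / 512) (by norm_num)).and
      (eventually_gt_atTop 0)))).exists
  obtain ⟨d, s, -, -, hs, -, -, hH, hlen⟩ := h1 id
  have h4 := hbound (loglogOrder c n) s
  rw [hs] at h4
  have h5 : 0 ≤ (n : ℝ) * modEntropy (loglogOrder c n) s :=
    mul_nonneg (by positivity) (modEntropy_nonneg _ _)
  have h6 : lam * ((n : ℝ) * modEntropy (loglogOrder c n) s) ≤ |lam| * Real.logb 2 n ^ e :=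
    (mul_le_mul_of_nonneg_right (le_abs_self lam) h5).trans
      (mul_le_mul_of_nonneg_left hH (abs_nonneg lam))
  have hn0 : (0 : ℝ) < n := by exact_mod_cast hn
  linarith

theorem mainTheorem2 (α : Type*) [Fintype α] [DecidableEq α] [Nontrivial α] :
    (∀ (C : List α → List Bool) (m p : ℕ → ℕ), Function.Injective C →
      OneStreamComputable C m p → PolyLog m → PolyLog p → ¬ AchievesEntropyOnlyBound C) ∧
    ∃ δ : ℝ, 0 < δ ∧
      ∀ (C : List α → List Bool) (m p : ℕ → ℕ), Function.Injective C →
        OneStreamComputable C m p → PolyLog m → PolyLog p →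
      ∀ k : ℕ → ℕ,
        Tendsto (fun n : ℕ => (2 : ℝ) ^ k n / (((m n : ℝ) + 1) * (p n : ℝ))) atTop atTop →
        PolyLog (fun n => 2 ^ k n) →
      ∀ φ : Bool → α, Function.Injective φ →
      ∃ c : ℕ, ∀ᶠ n : ℕ in atTop, ∀ D : List Bool → List Bool,
        ∃ (d : List Bool) (s : List α),
          IsDeBruijnCycle (k n) d ∧
          (∀ x : List Bool, D x = d → δ * (d.length : ℝ) ≤ (x.length : ℝ)) ∧
          s.length = n ∧
          IsPrefixOfPowers (d.map φ) s ∧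
          (n : ℝ) * modEntropy (k n) s ≤ 2 * (2 : ℝ) ^ k n * Real.logb 2 n ∧
          (n : ℝ) * modEntropy (k n) s ≤ (Real.logb 2 n) ^ c ∧
          δ * (n : ℝ) ≤ ((C s).length : ℝ) :=
  ⟨fun _ _ _ hinj hC hm hp => not_achievesEntropyOnlyBound hinj hC hm hp, 1 / 128, by norm_num,
    fun _ _ _ hinj hC _ _ _ hk hpk _ hφ => hC.eventually_exists_hard_word hinj hk hpk hφ⟩
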